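/- Conventions. A domain is a non-empty connected open set $D\subset\mathbb C$; $dA$ is area measure. A weight $\mu$ on $D$ (a positive measurable function) is admissible, $\mu\in AW(D)$, if the weighted Bergman space $A^2_\mu(D)=\{f\in\mathcal O(D):\int_D|f|^2\mu\,dA<\infty\}$ is closed in $L^2_\mu(D)$ and $f\mapsto f(z)$ is continuous on it for every $z\in D$. For $\mu\in AW(D)$, $n\ge 1$, $\zeta\in D$ let $$AD^\mu(D,\zeta^n)=\Big\{f\in\mathcal O(D): f(\zeta)=\dots=f^{(n-1)}(\zeta)=0,\ \int_D|f'|^2\mu\,dA<\infty\Big\},\qquad \langle f,g\rangle=\int_D f'\,\overline{g'}\,\mu\,dA ,$$ let $M_{D,\mu,n}(\cdot,\zeta)\in AD^\mu(D,\zeta^n)$ be the Riesz representative of $f\mapsto f^{(n)}(\zeta)$, and let $\tilde K_{D,\mu,n}(z,\zeta)=\frac{\partial}{\partial z}M_{D,\mu,n}(z,\zeta)$ be the $n$-th order weighted reduced Bergman kernel; write $\tilde K_{D,\mu}=\tilde K_{D,\mu,1}$. Let $N_D(\mu)=\{z\in D:\tilde K_{D,\mu}(z,z)=0\}$, let $$J_m(\zeta)=\det\Big(\frac{\partial^{j+k}}{\partial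 z^j\,\partial\bar\zeta^k}\tilde K_{D,\mu}(z,\zeta)\Big|_{z=\zeta}\Big)_{j,k=0}^{m},$$ and for $n\ge2$ let $R_n=R_n(D,\mu)=\{\zeta\in D\setminus N_D(\mu): J_{n-2}(\zeta)\neq 0\}$. (Thus $R_2=D\setminus N_D(\mu)$, and $R_n=D\setminus N_D(\mu)$ whenever $J_{n-2}>0$ on $D\setminus N_D(\mu)$, e.g. if $D$ is bounded and $\mu\in L^1(D)$.) Theorem. Let $\{D_i\}_{i\ge1}$ be a sequence of domains in $\mathbb C$ and $\mu_i\in AW(D_i)$. (1) Let $D=\bigcup_i D_i$ and $\mu\in AW(D)$. Assume that for every $i$ there is $j(i)$ such that $D_i\subset D_k$ and $\mu_i(z)\le\mu_k(z)\le\mu(z)$ for all $k\ge j(i)$ and $z\in D_i$, and that $\mu_i\to\mu$ pointwise a.e. on $D$. Then: (A) $\tilde K_{D_i,\mu_i}\to\tilde K_{D,\mu}$ locally uniformly on $D\times D$. (B) For every $n>1$ and $w\in D$, $\tilde K_{D_i,\mu_i,n}(\cdot,w)\to\tilde K_{D,\mu,n}(\cdot,w)$ locally uniformly on $D$; in particular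 $\tilde K_{D_i,\mu_i,n}\to\tilde K_{D,\mu,n}$ pointwise on $D\times D$. Furthermore, $\tilde K_{D,\mu,n}$ is $C^\infty$ on $D\times R_n$, on every compact subset of $D\times R_n$ the kernels $\tilde K_{D_i,\mu_i,n}$ are $C^\infty$ for all large $i$, and all derivatives of $\tilde K_{D_i,\mu_i,n}$ converge locally uniformly on $D\times R_n$ to the respective derivatives of $\tilde K_{D,\mu,n}$. (2) Suppose that $D=\bigcap_i D_i$ is a domain and that $\mu\in AW(D)$ satisfies $\mu(z)\le\mu_i(z)$ for all $i$ and $z\in D$. Assume that $\mu_i\to\mu$ pointwise a.e. on $D$ and that $\lim_{i\to\infty}\tilde K_{D_i,\mu_i}(t,t)=\tilde K_{D,\mu}(t,t)$ for every $t\in D$. Then: (A) $\tilde K_{D_i,\mu_i}\to\tilde K_{D,\mu}$ locally uniformly on $D\times D$. (B) For every $n>1$, $\tilde K_{D,\mu,n}$ is $C^\infty$ on $D\times R_n$, on every compact subset of $D\times R_n$ the kernels $\tilde K_{D_i,\mu_i,n}$ are $C^\infty$ for all large $i$, and all derivatives of $\tilde K_{D_i,\mu_i,n}$ converge locally uniformly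 on $D\times R_n$ to the respective derivatives of $\tilde K_{D,\mu,n}$. -/

import Mathlib

open MeasureTheory Filter Topology
open scoped ContDiff ComplexConjugate

noncomputable section

/-- The measure `μ dA` on `D`, where `dA` is the area measure of the plane. -/
def weightedArea (D : Set ℂ) (μ : ℂ → ℝ) : Measure ℂ :=
  (volume.restrict D).withDensity (fun z => ENNReal.ofReal (μ z))

/-- `f` belongs to the weighted Bergman space `A²_μ(D)`: it is holomorphic on `D` and
`∫_D |f|² μ dA < ∞`. -/
def MemBergman (D : Set ℂ) (μ : ℂ → ℝ) (f : ℂ → ℂ) : Prop :=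
  DifferentiableOn ℂ f D ∧ MemLp f 2 (weightedArea D μ)

/-- Admissible weights in the sense of Pasternak-Winiarski: a positive (Lebesgue) measurable
function on `D` for which the weighted Bergman space is closed in `L²_μ(D)` and all
point evaluations are bounded on it. Values of `μ` outside `D` play no role. -/
structure IsAdmissibleWeight (D : Set ℂ) (μ : ℂ → ℝ) : Prop where
  measurable : AEMeasurable μ (volume.restrict D)
  pos : ∀ z ∈ D, 0 < μ z
  closed : IsClosed {g : Lp ℂ 2 (weightedArea D μ) |
    ∃ f : ℂ → ℂ, MemBergman D μ f ∧ g =ᵐ[weightedArea D μ] f}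
  eval_bounded : ∀ z ∈ D, ∃ C : ℝ, ∀ f : ℂ → ℂ, MemBergman D μ f →
    ‖f z‖ ≤ C * (eLpNorm f 2 (weightedArea D μ)).toReal

/-- `f` belongs to `AD^μ(D, ζⁿ)`: it is holomorphic on `D`, it vanishes at `ζ` together with its
derivatives of order less than `n`, and `∫_D |f'|² μ dA < ∞`. -/
def MemAD (D : Set ℂ) (μ : ℂ → ℝ) (n : ℕ) (ζ : ℂ) (f : ℂ → ℂ) : Prop :=
  DifferentiableOn ℂ f D ∧ (∀ k < n, iteratedDeriv k f ζ = 0) ∧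
    MemLp (deriv f) 2 (weightedArea D μ)

/-- `M` represents the functional `f ↦ f⁽ⁿ⁾(ζ)` on `AD^μ(D, ζⁿ)` with respect to the inner product
`⟨f, g⟩ = ∫_D f' conj(g') μ dA`. -/
def IsKernelFunction (D : Set ℂ) (μ : ℂ → ℝ) (n : ℕ) (ζ : ℂ) (M : ℂ → ℂ) : Prop :=
  MemAD D μ n ζ M ∧ ∀ f : ℂ → ℂ, MemAD D μ n ζ f →
    iteratedDeriv n f ζ = ∫ z, deriv f z * conj (deriv M z) ∂(weightedArea D μ)

open Classical in
/-- The `n`-th order kernel function `M_{D,μ,n}(·, ζ)`, i.e. the Riesz representative of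
`f ↦ f⁽ⁿ⁾(ζ)`. For a domain `D`, an admissible weight `μ`, `ζ ∈ D` and `n ≥ 1` it exists and
is unique as a function on `D`; otherwise the value is `0` by convention. -/
def kernelFunction (D : Set ℂ) (μ : ℂ → ℝ) (n : ℕ) (ζ : ℂ) : ℂ → ℂ :=
  if h : ∃ M : ℂ → ℂ, IsKernelFunction D μ n ζ M then h.choose else 0

/-- The `n`-th order weighted reduced Bergman kernel
`K̃_{D,μ,n}(z, ζ) = ∂/∂z M_{D,μ,n}(z, ζ)`; `n = 1` is the weighted reduced Bergman kernel. -/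
def reducedKernel (D : Set ℂ) (μ : ℂ → ℝ) (n : ℕ) (z ζ : ℂ) : ℂ :=
  deriv (kernelFunction D μ n ζ) z

/-- The set `N_D(μ)` of zeros of the reduced Bergman kernel on the diagonal. -/
def diagZeros (D : Set ℂ) (μ : ℂ → ℝ) : Set ℂ :=
  {z | z ∈ D ∧ reducedKernel D μ 1 z z = 0}

/-- The mixed derivative `∂^{j+k} / ∂z^j ∂ζ̄^k` of the first-order kernel. Since the kernel is
anti-holomorphic in `ζ`, its `ζ̄`-derivative is the conjugate of the complex derivative of the
conjugated kernel. -/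
def kernelMixedDeriv (D : Set ℂ) (μ : ℂ → ℝ) (j k : ℕ) (z ζ : ℂ) : ℂ :=
  iteratedDeriv j
    (fun z' => conj (iteratedDeriv k (fun ζ' => conj (reducedKernel D μ 1 z' ζ')) ζ)) z

/-- The determinant `J_m(ζ)` of the matrix of mixed derivatives of orders `0 ≤ j, k ≤ m` of the
first-order kernel at `(ζ, ζ)`. -/
def kernelGramDet (D : Set ℂ) (μ : ℂ → ℝ) (m : ℕ) (ζ : ℂ) : ℂ :=
  Matrix.det (Matrix.of fun j k : Fin (m + 1) => kernelMixedDeriv D μ j k ζ ζ)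

/-- The points of `D \ N_D(μ)` at which `J_{n-2}` does not vanish (`n ≥ 2`). -/
def regularPoints (D : Set ℂ) (μ : ℂ → ℝ) (n : ℕ) : Set ℂ :=
  {ζ | ζ ∈ D \ diagZeros D μ ∧ kernelGramDet D μ (n - 2) ζ ≠ 0}

/-- All derivatives (in the real sense, hence all partial derivatives in `z, z̄, ζ, ζ̄`, of every
order including `0`) of `F i` converge locally uniformly on `U` to those of `f`. The derivatives
really exist: `f` is smooth at all points of `U`, and on each compact subset of `U` all
but finitely many of the `F i` are smooth. -/
def AllDerivsTendstoLocallyUniformlyOn (F : ℕ → ℂ × ℂ → ℂ) (f : ℂ × ℂ → ℂ)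
    (U : Set (ℂ × ℂ)) : Prop :=
  (∀ p ∈ U, ContDiffAt ℝ ∞ f p) ∧
  (∀ L ⊆ U, IsCompact L → ∀ᶠ i in atTop, ∀ p ∈ L, ContDiffAt ℝ ∞ (F i) p) ∧
  ∀ m : ℕ, TendstoLocallyUniformlyOn (fun i => iteratedFDeriv ℝ m (F i))
    (iteratedFDeriv ℝ m f) atTop U

end

/-! Differentiation identifies `AD^μ(D, ζ^{m+1})` with the functions that vanish to order `m` at `ζ`
in the reduced Bergman space, the space of square integrable holomorphic functions having a
primitive. The kernel of order `m + 1` becomes the Riesz representer `κ` of `h ↦ h⁽ᵐ⁾(ζ)` there, and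
`κ⁽ᵐ⁾(ζ) = ‖κ‖²`.

The metric input is a comparison of nested domains (`weightedNormSq_sub_reducedRep_le`). If `D' ⊆ D`
and `μ' ≤ μ` on `D'`, then `κ` restricts to `D'` and the reproducing property of `κ'` gives `⟨κ',
κ⟩_{D'} = ‖κ‖²_D`, so `‖κ' - κ‖²_{D'} ≤ ‖κ'‖²_{D'} - ‖κ‖²_D`. Point evaluations are bounded on
compact sets, hence convergence of the norms forces locally uniform convergence of the kernels.

In the decreasing case, convergence of the norms is the hypothesis on the diagonal. In the
increasing case the squared norms of the kernels of each order have a limit `α`, and the kernels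
themselves converge to some `h`. Fatou gives `‖h‖² ≤ α`, while `h⁽ᵐ⁾(w) = α`. Expanding `0 ≤ ‖h -
κ‖²` yields `α ≤ ‖κ‖²`, and the comparison yields `‖κ‖² ≤ α`.

Smooth convergence in both variables follows from `KernelConvergence`, which both cases satisfy:
pointwise convergence and local boundedness of the first-order kernels. Cauchy estimates and
Hermitian symmetry carry these to all mixed derivatives. Off the zeros of the Gram determinant, a
kernel of order `n ≥ 2` arises by orthogonalising the representer of the derivative of order `n - 1`
against those of lower order. Cramer's rule (`reducedKernel_eq`) writes it through mixed derivatives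
and the inverse determinant, and sums, products and inverses preserve convergence of all derivatives
(`SmoothTendsto`). -/

/-! ### Locally uniform limits, derivatives and primitives -/

theorem DifferentiableOn.iteratedDeriv_of_isOpen {D : Set ℂ} (hD : IsOpen D) {h : ℂ → ℂ}
    (hh : DifferentiableOn ℂ h D) (k : ℕ) : DifferentiableOn ℂ (iteratedDeriv k h) D := by
  induction k with
  | zero => simpa using hh
  | succ k ih => rw [iteratedDeriv_succ]; exact ih.deriv hD

theorem TendstoLocallyUniformlyOn.iteratedDeriv_of_isOpen {D : Set ℂ} (hD : IsOpen D)
    {F : ℕ → ℂ → ℂ} {f : ℂ → ℂ} (hF : TendstoLocallyUniformlyOn F f atTop D)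
    (hd : ∀ᶠ i in atTop, DifferentiableOn ℂ (F i) D) (k : ℕ) :
    TendstoLocallyUniformlyOn (fun i => iteratedDeriv k (F i)) (iteratedDeriv k f) atTop D := by
  induction k with
  | zero => simpa using hF
  | succ k ih =>
    simp only [iteratedDeriv_succ]
    exact ih.deriv (hd.mono fun i hi => hi.iteratedDeriv_of_isOpen hD k) hD

/-- A locally uniform limit of functions with primitives on a domain has a primitive; the functions
need to be defined only eventually near each point. -/
theorem exists_primitive_of_tendstoLocallyUniformlyOn {Ω : Set ℂ} (hΩ : IsOpen Ω)
    (hc : IsPreconnected Ω) {f h : ℕ → ℂ → ℂ} {g : ℂ → ℂ}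
    (hlim : TendstoLocallyUniformlyOn h g atTop Ω)
    (hf : ∀ z ∈ Ω, ∃ r > 0, Metric.ball z r ⊆ Ω ∧
      ∀ᶠ i in atTop, ∀ y ∈ Metric.ball z r, HasDerivAt (f i) (h i y) y) :
    ∃ G : ℂ → ℂ, ∀ z ∈ Ω, HasDerivAt G (g z) z := by
  rcases Ω.eq_empty_or_nonempty with rfl | ⟨z₀, hz₀⟩
  · exact ⟨0, by simp⟩
  -- Primitives are free up to constants; normalising at `z₀` makes them converge there.
  let φ : ℕ → ℂ → ℂ := fun i z => f i z - f i z₀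
  have hφ : ∀ z ∈ Ω, ∃ r > 0, Metric.ball z r ⊆ Ω ∧
      ∀ᶠ i in atTop, ∀ y ∈ Metric.ball z r, HasDerivAt (φ i) (h i y) y := fun z hz => by
    obtain ⟨r, hr, hs, he⟩ := hf z hz
    exact ⟨r, hr, hs, he.mono fun i hi y hy => (hi y hy).sub_const _⟩
  have key : ∀ z ∈ Ω, ∃ r > 0, Metric.ball z r ⊆ Ω ∧
      ∀ x ∈ Metric.ball z r, ∀ y ∈ Metric.ball z r,
      Cauchy (map (fun i => φ i x) atTop) → Cauchy (map (fun i => φ i y) atTop) := by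
    intro z hz
    obtain ⟨r, hr, hs, he⟩ := hφ z hz
    obtain ⟨s, hs', hu⟩ : ∃ s ∈ 𝓝 z, TendstoUniformlyOn h g atTop s := by
      obtain ⟨ρ, hρ, hb⟩ := Metric.nhds_basis_closedBall.mem_iff.1 (hΩ.mem_nhds hz)
      exact ⟨_, Metric.closedBall_mem_nhds z hρ,
        (tendstoLocallyUniformlyOn_iff_forall_isCompact hΩ).1 hlim _ hb (isCompact_closedBall z ρ)⟩
    obtain ⟨ρ, hρ, hb⟩ := Metric.nhds_basis_ball.mem_iff.1 hs'
    refine ⟨min r ρ, lt_min hr hρ, (Metric.ball_subset_ball (min_le_left _ _)).trans hs, ?_⟩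
    intro x hx y hy hcx
    obtain ⟨N, hN⟩ := eventually_atTop.1 he
    -- The derivative is known only from index `N` on, while the Cauchy criterion used below wants
    -- it for every index.
    have hshift : ∀ u : ℂ, (Cauchy (map (fun i => φ (i + N) u) atTop) ↔
        Cauchy (map (fun i => φ i u) atTop)) := fun u => by
      have : map (fun i => φ (i + N) u) atTop = map (fun i => φ i u) atTop := by
        rw [show (fun i => φ (i + N) u) = (fun i => φ i u) ∘ (fun i => i + N) from rfl,
          ← Filter.map_map, map_add_atTop_eq_nat]
      rw [this]
    rw [← hshift] at hcx ⊢
    have hu' : UniformCauchySeqOn (fun i => h (i + N)) atTop (Metric.ball z (min r ρ)) := by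
      have := (hu.mono ((Metric.ball_subset_ball (min_le_right r ρ)).trans hb))
      refine TendstoUniformlyOn.uniformCauchySeqOn (f := g) ?_
      exact fun u hu => (tendsto_add_atTop_nat N).eventually (this u hu)
    have hder : ∀ i, ∀ y ∈ Metric.ball z (min r ρ),
        HasFDerivAt (φ (i + N)) ((1 : ℂ →L[ℂ] ℂ).smulRight (h (i + N) y)) y := fun i y hy =>
      (hN (i + N) (by omega) y (Metric.ball_subset_ball (min_le_left _ _) hy)).hasFDerivAt
    refine cauchy_map_of_uniformCauchySeqOn_fderiv Metric.isOpen_ball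
      (convex_ball z (min r ρ)).isPreconnected ?_ hder hx hy hcx
    exact (ContinuousLinearMap.smulRightL ℂ ℂ ℂ 1).uniformContinuous.comp_uniformCauchySeqOn hu'
  -- By `key` the set of convergence is open and relatively closed in `Ω`, and it contains `z₀`;
  -- connectedness finishes.
  have hall : Ω ⊆ {x | x ∈ Ω ∧ Cauchy (map (fun i => φ i x) atTop)} := by
    refine hc.subset_of_closure_inter_subset ?_ ⟨z₀, hz₀, hz₀, ?_⟩ ?_
    · rw [isOpen_iff_mem_nhds]
      rintro z ⟨hz, hcz⟩
      obtain ⟨r, hr, hs, H⟩ := key z hz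
      filter_upwards [Metric.ball_mem_nhds z hr] with y hy
      exact ⟨hs hy, H z (Metric.mem_ball_self hr) y hy hcz⟩
    · have : (fun i => φ i z₀) = fun _ => (0 : ℂ) := by ext; simp [φ]
      rw [this]
      exact (tendsto_const_nhds (x := (0 : ℂ))).cauchy_map
    · rintro z ⟨hz, hzΩ⟩
      obtain ⟨r, hr, hs, H⟩ := key z hzΩ
      obtain ⟨y, ⟨hyΩ, hcy⟩, hy⟩ := Metric.mem_closure_iff.1 hz r hr
      exact ⟨hzΩ, H y (by simpa [dist_comm] using hy) z (Metric.mem_ball_self hr) hcy⟩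
  have hex : ∀ z, ∃ c, z ∈ Ω → Tendsto (fun i => φ i z) atTop (𝓝 c) := fun z => by
    by_cases hz : z ∈ Ω
    · obtain ⟨c, hc⟩ := cauchy_map_iff_exists_tendsto.1 (hall hz).2
      exact ⟨c, fun _ => hc⟩
    · exact ⟨0, fun h => absurd h hz⟩
  choose G hG using hex
  refine ⟨G, fun z hz => ?_⟩
  obtain ⟨r, hr, hs, he⟩ := hφ z hz
  refine hasDerivAt_of_tendstoLocallyUniformlyOn Metric.isOpen_ball (hlim.mono hs) he
    (fun x hx => hG x (hs hx)) (Metric.mem_ball_self hr)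

/-! ### The reduced Bergman space and bounds for point evaluations -/

/-- The reduced Bergman space: holomorphic square integrable functions with a primitive. -/
def MemReduced (D : Set ℂ) (μ : ℂ → ℝ) (h : ℂ → ℂ) : Prop :=
  (∃ f : ℂ → ℂ, ∀ z ∈ D, HasDerivAt f (h z) z) ∧ MemLp h 2 (weightedArea D μ)

/-- The inner product of `L²_μ(D)`. -/
noncomputable def weightedInner (D : Set ℂ) (μ : ℂ → ℝ) (h g : ℂ → ℂ) : ℂ :=
  ∫ z, h z * conj (g z) ∂(weightedArea D μ)

/-- The squared norm of `L²_μ(D)`. -/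
noncomputable def weightedNormSq (D : Set ℂ) (μ : ℂ → ℝ) (h : ℂ → ℂ) : ℝ :=
  ∫ z, ‖h z‖ ^ 2 ∂(weightedArea D μ)

section Basics

variable {D : Set ℂ} {μ : ℂ → ℝ} {h g : ℂ → ℂ}

theorem MemReduced.differentiableOn (hD : IsOpen D) (hh : MemReduced D μ h) :
    DifferentiableOn ℂ h D := by
  obtain ⟨⟨f, hf⟩, -⟩ := hh
  have h1 : DifferentiableOn ℂ f D := fun z hz => (hf z hz).differentiableAt.differentiableWithinAt
  exact (h1.deriv hD).congr fun z hz => (hf z hz).deriv.symm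

theorem MemReduced.memBergman (hD : IsOpen D) (hh : MemReduced D μ h) : MemBergman D μ h :=
  ⟨hh.differentiableOn hD, hh.2⟩

theorem MemReduced.add (hh : MemReduced D μ h) (hg : MemReduced D μ g) :
    MemReduced D μ (h + g) := by
  obtain ⟨⟨f, hf⟩, h2⟩ := hh
  obtain ⟨⟨f', hf'⟩, h2'⟩ := hg
  exact ⟨⟨f + f', fun z hz => (hf z hz).add (hf' z hz)⟩, h2.add h2'⟩

theorem MemReduced.sub (hh : MemReduced D μ h) (hg : MemReduced D μ g) :
    MemReduced D μ (h - g) := by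
  obtain ⟨⟨f, hf⟩, h2⟩ := hh
  obtain ⟨⟨f', hf'⟩, h2'⟩ := hg
  exact ⟨⟨f - f', fun z hz => (hf z hz).sub (hf' z hz)⟩, h2.sub h2'⟩

theorem MemReduced.const_smul (c : ℂ) (hh : MemReduced D μ h) : MemReduced D μ (c • h) := by
  obtain ⟨⟨f, hf⟩, h2⟩ := hh
  exact ⟨⟨c • f, fun z hz => (hf z hz).const_smul c⟩, h2.const_smul c⟩

theorem MemReduced.zero : MemReduced D μ 0 :=
  ⟨⟨0, fun z _ => hasDerivAt_const z 0⟩, MemLp.zero⟩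

theorem MemReduced.sum {ι : Type*} (s : Finset ι) {h : ι → ℂ → ℂ}
    (hh : ∀ i, MemReduced D μ (h i)) : MemReduced D μ (∑ i ∈ s, h i) := by
  classical
  induction s using Finset.induction_on with
  | empty => simpa using MemReduced.zero
  | insert a s ha ih => rw [Finset.sum_insert ha]; exact (hh a).add ih

theorem weightedInner_eq_inner (hh : MemLp h 2 (weightedArea D μ))
    (hg : MemLp g 2 (weightedArea D μ)) :
    -- The arguments swap because `inner` is conjugate linear in its first slot.
    weightedInner D μ h g = inner ℂ hg.toLp hh.toLp := by
  rw [L2.inner_def, weightedInner]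
  refine integral_congr_ae ?_
  filter_upwards [hh.coeFn_toLp, hg.coeFn_toLp] with z h1 h2
  rw [h1, h2, RCLike.inner_apply]

theorem weightedInner_self (h : ℂ → ℂ) :
    weightedInner D μ h h = (weightedNormSq D μ h : ℂ) := by
  rw [weightedInner, weightedNormSq, ← integral_complex_ofReal]
  refine integral_congr_ae (Eventually.of_forall fun z => ?_)
  simp [Complex.mul_conj, Complex.normSq_eq_norm_sq]

theorem weightedNormSq_eq_norm_sq (hh : MemLp h 2 (weightedArea D μ)) :
    weightedNormSq D μ h = ‖hh.toLp‖ ^ 2 := by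
  have h1 := weightedInner_self (D := D) (μ := μ) h
  rw [weightedInner_eq_inner hh hh, inner_self_eq_norm_sq_to_K] at h1
  refine Complex.ofReal_injective (h1.symm.trans ?_)
  simp

theorem weightedNormSq_nonneg (h : ℂ → ℂ) : 0 ≤ weightedNormSq D μ h :=
  integral_nonneg fun _ => by positivity

theorem conj_weightedInner (h g : ℂ → ℂ) :
    conj (weightedInner D μ h g) = weightedInner D μ g h := by
  rw [weightedInner, weightedInner, ← integral_conj]
  congr 1; ext z; simp [mul_comm]

theorem weightedNormSq_sub (hh : MemLp h 2 (weightedArea D μ))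
    (hg : MemLp g 2 (weightedArea D μ)) :
    weightedNormSq D μ (h - g) =
      weightedNormSq D μ h - 2 * (weightedInner D μ h g).re + weightedNormSq D μ g := by
  rw [weightedNormSq_eq_norm_sq (hh.sub hg), weightedNormSq_eq_norm_sq hh,
    weightedNormSq_eq_norm_sq hg, weightedInner_eq_inner hh hg, MemLp.toLp_sub,
    @norm_sub_sq ℂ, inner_re_symm]
  rfl

/-- The difference has norm zero, and bounded evaluations then annihilate it at every point. -/
theorem IsAdmissibleWeight.eqOn_of_ae_eq (hμ : IsAdmissibleWeight D μ) {f g : ℂ → ℂ}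
    (hf : MemBergman D μ f) (hg : MemBergman D μ g) (hfg : f =ᵐ[weightedArea D μ] g) :
    Set.EqOn f g D := by
  intro z hz
  obtain ⟨C, hC⟩ := hμ.eval_bounded z hz
  have := hC (f - g) ⟨hf.1.sub hg.1, hf.2.sub hg.2⟩
  have h0 : eLpNorm (f - g) 2 (weightedArea D μ) = 0 := by
    rw [eLpNorm_congr_ae (g := 0)]
    · simp
    · filter_upwards [hfg] with y hy; simp [hy]
  rw [h0] at this
  simpa [sub_eq_zero] using this

/-- Functions of the weighted Bergman space are bounded on compact sets by their norms. -/
theorem IsAdmissibleWeight.exists_bound_on_compact (hμ : IsAdmissibleWeight D μ) {L : Set ℂ}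
    (hL : IsCompact L) (hLD : L ⊆ D) :
    ∃ C : ℝ, ∀ h, MemBergman D μ h → ∀ z ∈ L,
      ‖h z‖ ≤ C * (eLpNorm h 2 (weightedArea D μ)).toReal := by
  let W : Submodule ℂ (Lp ℂ 2 (weightedArea D μ)) :=
    { carrier := {g | ∃ f, MemBergman D μ f ∧ g =ᵐ[weightedArea D μ] f}
      add_mem' := by
        rintro a b ⟨f, hf, haf⟩ ⟨f', hf', hbf⟩
        exact ⟨f + f', ⟨hf.1.add hf'.1, hf.2.add hf'.2⟩, (Lp.coeFn_add a b).trans (haf.add hbf)⟩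
      zero_mem' := ⟨0, ⟨differentiableOn_const 0, MemLp.zero⟩, Lp.coeFn_zero _ _ _⟩
      smul_mem' := by
        rintro c a ⟨f, hf, haf⟩
        exact ⟨c • f, ⟨hf.1.const_smul c, hf.2.const_smul c⟩,
          (Lp.coeFn_smul c a).trans (haf.const_smul c)⟩ }
  have hW : IsClosed (W : Set (Lp ℂ 2 (weightedArea D μ))) := hμ.closed
  have : CompleteSpace W := hW.completeSpace_coe
  have huniq := fun f f' (hf : MemBergman D μ f) (hf' : MemBergman D μ f') =>
    hμ.eqOn_of_ae_eq hf hf'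
  choose rep hrep using fun g : W => g.2
  have hadd : ∀ a b : W, ∀ z ∈ D, rep (a + b) z = rep a z + rep b z := fun a b =>
    huniq _ (rep a + rep b) (hrep _).1
      ⟨(hrep a).1.1.add (hrep b).1.1, (hrep a).1.2.add (hrep b).1.2⟩ (by
        filter_upwards [(hrep (a + b)).2, Lp.coeFn_add a.1 b.1, (hrep a).2, (hrep b).2]
          with z h1 h2 h3 h4
        rw [← h1, Pi.add_apply, ← h3, ← h4, ← Pi.add_apply, ← h2]; rfl)
  have hsmul : ∀ (c : ℂ) (a : W), ∀ z ∈ D, rep (c • a) z = c • rep a z := fun c a =>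
    huniq _ (c • rep a) (hrep _).1
      ⟨(hrep a).1.1.const_smul c, (hrep a).1.2.const_smul c⟩ (by
        filter_upwards [(hrep (c • a)).2, Lp.coeFn_smul c a.1, (hrep a).2] with z h1 h2 h3
        rw [← h1, Pi.smul_apply, ← h3, ← Pi.smul_apply, ← h2]; rfl)
  have hexδ : ∀ z : L, ∃ δ : W →L[ℂ] ℂ, ∀ g, δ g = rep g z := by
    intro z
    obtain ⟨C, hC⟩ := hμ.eval_bounded z (hLD z.2)
    refine ⟨LinearMap.mkContinuous
      { toFun := fun g => rep g z
        map_add' := fun a b => hadd a b z (hLD z.2)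
        map_smul' := fun c a => hsmul c a z (hLD z.2) } C ?_, fun g => rfl⟩
    intro g
    have := hC (rep g) (hrep g).1
    rw [← eLpNorm_congr_ae (hrep g).2] at this
    exact this
  choose δ hδ using hexδ
  -- Each function is bounded on the compact `L` by continuity, so the evaluations at points of `L`
  -- are pointwise bounded. Completeness, from closedness of the Bergman space, makes the bound
  -- uniform.
  obtain ⟨C, hC⟩ := banach_steinhaus (g := δ) (by
    intro g
    obtain ⟨M, hM⟩ := hL.exists_bound_of_continuousOn ((hrep g).1.1.continuousOn.mono hLD)
    exact ⟨M, fun z => by rw [hδ]; exact hM z z.2⟩)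
  refine ⟨C, fun h hh z hz => ?_⟩
  let g : W := ⟨hh.2.toLp, h, hh, hh.2.coeFn_toLp⟩
  have h1 : h z = δ ⟨z, hz⟩ g := by
    rw [hδ]
    exact (huniq _ _ (hrep g).1 hh ((hrep g).2.symm.trans hh.2.coeFn_toLp) (hLD hz)).symm
  rw [h1]
  refine ((δ ⟨z, hz⟩).le_of_opNorm_le (hC _) g).trans (le_of_eq ?_)
  congr 1
  exact Lp.norm_toLp h hh.2

/-- The squared form of `exists_bound_on_compact` on the reduced space. -/
theorem IsAdmissibleWeight.exists_sq_bound_on_compact (hμ : IsAdmissibleWeight D μ)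
    (hD : IsOpen D) {L : Set ℂ} (hL : IsCompact L) (hLD : L ⊆ D) :
    ∃ C : ℝ, 0 ≤ C ∧ ∀ h, MemReduced D μ h → ∀ z ∈ L, ‖h z‖ ^ 2 ≤ C * weightedNormSq D μ h := by
  obtain ⟨C, hC⟩ := hμ.exists_bound_on_compact hL hLD
  refine ⟨C ^ 2, sq_nonneg C, fun h hh z hz => ?_⟩
  have := hC h (hh.memBergman hD) z hz
  rw [weightedNormSq_eq_norm_sq hh.2, Lp.norm_toLp, ← mul_pow]
  exact pow_le_pow_left₀ (norm_nonneg _) this 2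

end Basics

/-! ### Riesz representation of derivative functionals -/

section Riesz

variable {D : Set ℂ} {μ : ℂ → ℝ}

theorem iteratedDeriv_congr_of_eqOn (hD : IsOpen D) {h g : ℂ → ℂ} (hg : Set.EqOn h g D) {ζ : ℂ}
    (hζ : ζ ∈ D) (k : ℕ) : iteratedDeriv k h ζ = iteratedDeriv k g ζ :=
  (hg.eventuallyEq_of_mem (hD.mem_nhds hζ)).iteratedDeriv_eq k

theorem iteratedDeriv_add_of_isOpen (hD : IsOpen D) {h g : ℂ → ℂ} (hh : DifferentiableOn ℂ h D)
    (hg : DifferentiableOn ℂ g D) {ζ : ℂ} (hζ : ζ ∈ D) (k : ℕ) :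
    iteratedDeriv k (h + g) ζ = iteratedDeriv k h ζ + iteratedDeriv k g ζ :=
  iteratedDeriv_add ((hh.contDiffOn hD).contDiffAt (hD.mem_nhds hζ))
    ((hg.contDiffOn hD).contDiffAt (hD.mem_nhds hζ))

theorem iteratedDeriv_sub_of_isOpen (hD : IsOpen D) {h g : ℂ → ℂ} (hh : DifferentiableOn ℂ h D)
    (hg : DifferentiableOn ℂ g D) {ζ : ℂ} (hζ : ζ ∈ D) (k : ℕ) :
    iteratedDeriv k (h - g) ζ = iteratedDeriv k h ζ - iteratedDeriv k g ζ :=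
  iteratedDeriv_sub ((hh.contDiffOn hD).contDiffAt (hD.mem_nhds hζ))
    ((hg.contDiffOn hD).contDiffAt (hD.mem_nhds hζ))

theorem iteratedDeriv_const_smul_of_isOpen (hD : IsOpen D) {h : ℂ → ℂ}
    (hh : DifferentiableOn ℂ h D) (c : ℂ) {ζ : ℂ} (hζ : ζ ∈ D) (k : ℕ) :
    iteratedDeriv k (c • h) ζ = c * iteratedDeriv k h ζ :=
  iteratedDeriv_const_smul ((hh.contDiffOn hD).contDiffAt (hD.mem_nhds hζ)) c

theorem IsAdmissibleWeight.exists_iteratedDeriv_bound (hμ : IsAdmissibleWeight D μ)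
    (hD : IsOpen D) {ζ : ℂ} (hζ : ζ ∈ D) (k : ℕ) :
    ∃ C : ℝ, ∀ h, MemBergman D μ h →
      ‖iteratedDeriv k h ζ‖ ≤ C * (eLpNorm h 2 (weightedArea D μ)).toReal := by
  obtain ⟨r, hr, hb⟩ := Metric.nhds_basis_closedBall.mem_iff.1 (hD.mem_nhds hζ)
  obtain ⟨C, hC⟩ := hμ.exists_bound_on_compact (isCompact_closedBall ζ r) hb
  refine ⟨k.factorial * C / r ^ k, fun h hh => ?_⟩
  refine (Complex.norm_iteratedDeriv_le_of_forall_mem_sphere_norm_le k hr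
    (DifferentiableOn.diffContOnCl_ball (hh.1) hb)
    (fun z hz => hC h hh z (Metric.sphere_subset_closedBall hz))).trans (le_of_eq ?_)
  ring

theorem IsAdmissibleWeight.tendstoLocallyUniformlyOn (hμ : IsAdmissibleWeight D μ)
    (hD : IsOpen D) {F : ℕ → ℂ → ℂ} {f : ℂ → ℂ} (hF : ∀ i, MemBergman D μ (F i))
    (hf : MemBergman D μ f)
    (hlim : Tendsto (fun i => eLpNorm (F i - f) 2 (weightedArea D μ)) atTop (𝓝 0)) :
    TendstoLocallyUniformlyOn F f atTop D := by
  rw [tendstoLocallyUniformlyOn_iff_forall_isCompact hD]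
  intro L hLD hL
  obtain ⟨C, hC⟩ := hμ.exists_bound_on_compact hL hLD
  rw [Metric.tendstoUniformlyOn_iff]
  intro ε hε
  have h1 : Tendsto (fun i => C * (eLpNorm (F i - f) 2 (weightedArea D μ)).toReal) atTop (𝓝 0) := by
    simpa using ((ENNReal.tendsto_toReal ENNReal.zero_ne_top).comp hlim).const_mul C
  filter_upwards [h1.eventually (gt_mem_nhds hε)] with i hi z hz
  rw [dist_comm, dist_eq_norm]
  exact (hC (F i - f) ⟨(hF i).1.sub hf.1, (hF i).2.sub hf.2⟩ z hz).trans_lt hi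

/-- Riesz representation of `h ↦ h⁽ⁿ⁾(ζ)` on the functions of the reduced Bergman space that
vanish to order `m` at `ζ`. -/
theorem IsAdmissibleWeight.exists_representer (hμ : IsAdmissibleWeight D μ) (hD : IsOpen D)
    (hc : IsPreconnected D) {ζ : ℂ} (hζ : ζ ∈ D) (m n : ℕ) :
    ∃ κ, MemReduced D μ κ ∧ (∀ k < m, iteratedDeriv k κ ζ = 0) ∧
      ∀ h, MemReduced D μ h → (∀ k < m, iteratedDeriv k h ζ = 0) →
        iteratedDeriv n h ζ = weightedInner D μ h κ := by
  let W : Submodule ℂ (Lp ℂ 2 (weightedArea D μ)) :=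
    { carrier := {g | ∃ f, (MemReduced D μ f ∧ ∀ k < m, iteratedDeriv k f ζ = 0) ∧
        g =ᵐ[weightedArea D μ] f}
      add_mem' := by
        rintro a b ⟨f, ⟨hf, hf0⟩, haf⟩ ⟨f', ⟨hf', hf0'⟩, hbf⟩
        refine ⟨f + f', ⟨hf.add hf', fun k hk => ?_⟩, (Lp.coeFn_add a b).trans (haf.add hbf)⟩
        rw [iteratedDeriv_add_of_isOpen hD (hf.differentiableOn hD) (hf'.differentiableOn hD) hζ,
          hf0 k hk, hf0' k hk, add_zero]
      zero_mem' := ⟨0, ⟨MemReduced.zero, fun k _ => by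
        rw [show (0 : ℂ → ℂ) = fun _ => (0 : ℂ) from rfl, iteratedDeriv_const]; simp⟩,
        Lp.coeFn_zero _ _ _⟩
      smul_mem' := by
        rintro c a ⟨f, ⟨hf, hf0⟩, haf⟩
        refine ⟨c • f, ⟨hf.const_smul c, fun k hk => ?_⟩,
          (Lp.coeFn_smul c a).trans (haf.const_smul c)⟩
        rw [iteratedDeriv_const_smul_of_isOpen hD (hf.differentiableOn hD) c hζ, hf0 k hk,
          mul_zero] }
  -- Norm limits are locally uniform limits, which keep both the existence of a primitive and the
  -- vanishing conditions.
  have hW : IsClosed (W : Set (Lp ℂ 2 (weightedArea D μ))) := by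
    refine IsSeqClosed.isClosed fun g G hg hG => ?_
    choose f hf hgf using hg
    have hGB : G ∈ {g : Lp ℂ 2 (weightedArea D μ) |
        ∃ f : ℂ → ℂ, MemBergman D μ f ∧ g =ᵐ[weightedArea D μ] f} :=
      hμ.closed.mem_of_tendsto hG
        (Eventually.of_forall fun i => ⟨f i, (hf i).1.memBergman hD, hgf i⟩)
    obtain ⟨F, hF, hGF⟩ := hGB
    have hlim : TendstoLocallyUniformlyOn f F atTop D := by
      refine hμ.tendstoLocallyUniformlyOn hD (fun i => (hf i).1.memBergman hD) hF ?_
      refine ((Lp.tendsto_Lp_iff_tendsto_eLpNorm' g G).1 hG).congr fun i => ?_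
      exact eLpNorm_congr_ae ((hgf i).sub hGF)
    have hdiff := fun i => (hf i).1.differentiableOn hD
    choose p hp using fun i => (hf i).1.1
    refine ⟨F, ⟨⟨?_, hF.2⟩, fun k hk => ?_⟩, hGF⟩
    · refine exists_primitive_of_tendstoLocallyUniformlyOn hD hc (f := p) hlim fun z hz => ?_
      obtain ⟨r, hr, hb⟩ := Metric.nhds_basis_ball.mem_iff.1 (hD.mem_nhds hz)
      exact ⟨r, hr, hb, Eventually.of_forall fun i y hy => hp i y (hb hy)⟩
    · refine tendsto_nhds_unique
        ((hlim.iteratedDeriv_of_isOpen hD (Eventually.of_forall hdiff) k).tendsto_at hζ) ?_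
      simp [(hf _).2 k hk]
  have : CompleteSpace W := hW.completeSpace_coe
  choose rep hrep using fun g : W => g.2
  have hB := fun g : W => (hrep g).1.1.memBergman hD
  have hd := fun g : W => (hB g).1
  have hadd : ∀ a b : W, Set.EqOn (rep (a + b)) (rep a + rep b) D := fun a b =>
    hμ.eqOn_of_ae_eq (hB _) (((hrep a).1.1.add (hrep b).1.1).memBergman hD) (by
        filter_upwards [(hrep (a + b)).2, Lp.coeFn_add a.1 b.1, (hrep a).2, (hrep b).2]
          with z h1 h2 h3 h4
        rw [← h1, Pi.add_apply, ← h3, ← h4, ← Pi.add_apply, ← h2]; rfl)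
  have hsmul : ∀ (c : ℂ) (a : W), Set.EqOn (rep (c • a)) (c • rep a) D := fun c a =>
    hμ.eqOn_of_ae_eq (hB _) (((hrep a).1.1.const_smul c).memBergman hD) (by
        filter_upwards [(hrep (c • a)).2, Lp.coeFn_smul c a.1, (hrep a).2] with z h1 h2 h3
        rw [← h1, Pi.smul_apply, ← h3, ← Pi.smul_apply, ← h2]; rfl)
  obtain ⟨C, hC⟩ := hμ.exists_iteratedDeriv_bound hD hζ n
  let φ : W →L[ℂ] ℂ := LinearMap.mkContinuous
    { toFun := fun g => iteratedDeriv n (rep g) ζ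
      map_add' := fun a b => by
        rw [iteratedDeriv_congr_of_eqOn hD (hadd a b) hζ,
          iteratedDeriv_add_of_isOpen hD (hd a) (hd b) hζ]
      map_smul' := fun c a => by
        rw [iteratedDeriv_congr_of_eqOn hD (hsmul c a) hζ,
          iteratedDeriv_const_smul_of_isOpen hD (hd a) c hζ]
        rfl } C (by
      intro g
      have := hC (rep g) (hB g)
      rw [← eLpNorm_congr_ae (hrep g).2] at this
      exact this)
  let v : W := (InnerProductSpace.toDual ℂ W).symm φ
  refine ⟨rep v, (hrep v).1.1, (hrep v).1.2, fun h hh h0 => ?_⟩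
  let g : W := ⟨hh.2.toLp, h, ⟨hh, h0⟩, hh.2.coeFn_toLp⟩
  have h1 : inner ℂ v g = φ g := InnerProductSpace.toDual_symm_apply
  have h2 : φ g = iteratedDeriv n h ζ :=
    iteratedDeriv_congr_of_eqOn hD (hμ.eqOn_of_ae_eq (hB g) (hh.memBergman hD)
      ((hrep g).2.symm.trans hh.2.coeFn_toLp)) hζ n
  have h3 : (hrep v).1.1.2.toLp = v.1 := Lp.ext ((MemLp.coeFn_toLp _).trans (hrep v).2.symm)
  rw [weightedInner_eq_inner hh.2 (hrep v).1.1.2, h3, ← h2, ← h1]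
  rfl

end Riesz

/-! ### Kernels as representers, mixed derivatives and Cramer's formula -/

section Kernels

variable {D : Set ℂ} {μ : ℂ → ℝ}

theorem ae_mem_weightedArea (hD : IsOpen D) : ∀ᵐ z ∂(weightedArea D μ), z ∈ D :=
  (withDensity_absolutelyContinuous _ _).ae_le (ae_restrict_mem hD.measurableSet)

/-- `κ` represents `h ↦ h⁽ᵐ⁾(ζ)` on the functions of the reduced Bergman space that vanish
to order `m` at `ζ`. -/
def IsReducedRep (D : Set ℂ) (μ : ℂ → ℝ) (m : ℕ) (ζ : ℂ) (κ : ℂ → ℂ) : Prop :=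
  MemReduced D μ κ ∧ (∀ k < m, iteratedDeriv k κ ζ = 0) ∧
    ∀ h, MemReduced D μ h → (∀ k < m, iteratedDeriv k h ζ = 0) →
      iteratedDeriv m h ζ = weightedInner D μ h κ

/-- The primitive normalised to vanish at `ζ` gains one order of vanishing, whence `m + 1` against
`m`. -/
theorem MemReduced.exists_memAD (hD : IsOpen D) {ζ : ℂ} (hζ : ζ ∈ D) {m : ℕ} {h : ℂ → ℂ}
    (hh : MemReduced D μ h) (h0 : ∀ k < m, iteratedDeriv k h ζ = 0) :
    ∃ f, MemAD D μ (m + 1) ζ f ∧ Set.EqOn (deriv f) h D := by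
  obtain ⟨⟨f, hf⟩, h2⟩ := hh
  have hder : Set.EqOn (deriv (fun z => f z - f ζ)) h D := fun z hz => ((hf z hz).sub_const _).deriv
  refine ⟨fun z => f z - f ζ, ⟨fun z hz =>
    ((hf z hz).sub_const _).differentiableAt.differentiableWithinAt, ?_, ?_⟩, hder⟩
  · rintro (_ | k) hk
    · simp
    · rw [iteratedDeriv_succ', iteratedDeriv_congr_of_eqOn hD hder hζ]
      exact h0 k (by omega)
  · refine h2.ae_eq ?_
    filter_upwards [ae_mem_weightedArea hD] with z hz using (hder hz).symm

theorem MemAD.memReduced_deriv (hD : IsOpen D) {ζ : ℂ} {m : ℕ} {f : ℂ → ℂ}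
    (hf : MemAD D μ (m + 1) ζ f) :
    MemReduced D μ (deriv f) ∧ ∀ k < m, iteratedDeriv k (deriv f) ζ = 0 :=
  ⟨⟨⟨f, fun z hz => (hf.1.differentiableAt (hD.mem_nhds hz)).hasDerivAt⟩, hf.2.2⟩,
    fun k hk => by rw [← iteratedDeriv_succ']; exact hf.2.1 (k + 1) (by omega)⟩

theorem IsAdmissibleWeight.isKernelFunction (hμ : IsAdmissibleWeight D μ) (hD : IsOpen D)
    (hc : IsPreconnected D) {ζ : ℂ} (hζ : ζ ∈ D) (m : ℕ) :
    IsKernelFunction D μ (m + 1) ζ (kernelFunction D μ (m + 1) ζ) := by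
  have hex : ∃ M, IsKernelFunction D μ (m + 1) ζ M := by
    obtain ⟨κ, hκ, hκ0, hrep⟩ := hμ.exists_representer hD hc hζ m m
    obtain ⟨M, hM, hMκ⟩ := hκ.exists_memAD hD hζ hκ0
    refine ⟨M, hM, fun f hf => ?_⟩
    obtain ⟨h1, h2⟩ := hf.memReduced_deriv hD
    rw [iteratedDeriv_succ', hrep _ h1 h2]
    refine integral_congr_ae ?_
    filter_upwards [ae_mem_weightedArea hD] with z hz
    rw [hMκ hz]
  rw [kernelFunction, dif_pos hex]
  exact hex.choose_spec

/-- The bridge from the definition of the kernels to Hilbert space arguments: only this description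
is used later. -/
theorem IsAdmissibleWeight.isReducedRep (hμ : IsAdmissibleWeight D μ) (hD : IsOpen D)
    (hc : IsPreconnected D) {ζ : ℂ} (hζ : ζ ∈ D) (m : ℕ) :
    IsReducedRep D μ m ζ (fun z => reducedKernel D μ (m + 1) z ζ) := by
  obtain ⟨hM, hrep⟩ := hμ.isKernelFunction hD hc hζ m
  obtain ⟨h1, h2⟩ := hM.memReduced_deriv hD
  refine ⟨h1, h2, fun h hh h0 => ?_⟩
  obtain ⟨f, hf, hfh⟩ := hh.exists_memAD hD hζ h0
  rw [← iteratedDeriv_congr_of_eqOn hD hfh hζ, ← iteratedDeriv_succ', hrep f hf]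
  refine integral_congr_ae ?_
  filter_upwards [ae_mem_weightedArea hD] with z hz
  rw [hfh hz]; rfl

theorem weightedInner_sub_left {h g k : ℂ → ℂ} (hh : MemReduced D μ h) (hg : MemReduced D μ g)
    (hk : MemReduced D μ k) :
    weightedInner D μ (h - g) k = weightedInner D μ h k - weightedInner D μ g k := by
  rw [weightedInner_eq_inner (hh.sub hg).2 hk.2, weightedInner_eq_inner hh.2 hk.2,
    weightedInner_eq_inner hg.2 hk.2, MemLp.toLp_sub, inner_sub_right]

theorem weightedInner_smul_left {h k : ℂ → ℂ} (hh : MemReduced D μ h) (hk : MemReduced D μ k)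
    (c : ℂ) : weightedInner D μ (c • h) k = c * weightedInner D μ h k := by
  rw [weightedInner_eq_inner (hh.const_smul c).2 hk.2, weightedInner_eq_inner hh.2 hk.2,
    MemLp.toLp_const_smul, inner_smul_right]

theorem weightedInner_sum_left {ι : Type*} (s : Finset ι) {h : ι → ℂ → ℂ} {k : ℂ → ℂ}
    (hh : ∀ i, MemReduced D μ (h i)) (hk : MemReduced D μ k) :
    weightedInner D μ (∑ i ∈ s, h i) k = ∑ i ∈ s, weightedInner D μ (h i) k := by
  classical
  induction s using Finset.induction_on with
  | empty => simp [weightedInner]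
  | insert a s ha ih =>
    rw [Finset.sum_insert ha, Finset.sum_insert ha, ← ih,
      weightedInner_eq_inner ((hh a).add (MemReduced.sum s hh)).2 hk.2,
      weightedInner_eq_inner (hh a).2 hk.2, weightedInner_eq_inner (MemReduced.sum s hh).2 hk.2,
      MemLp.toLp_add, inner_add_right]

theorem IsReducedRep.iteratedDeriv_self {m : ℕ} {ζ : ℂ} {κ : ℂ → ℂ}
    (hκ : IsReducedRep D μ m ζ κ) : iteratedDeriv m κ ζ = weightedNormSq D μ κ := by
  rw [hκ.2.2 κ hκ.1 hκ.2.1, weightedInner_self]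

/-- The difference of two representers is itself admissible as a test function, so it is orthogonal
to itself. -/
theorem IsReducedRep.eqOn (hμ : IsAdmissibleWeight D μ) (hD : IsOpen D) {m : ℕ} {ζ : ℂ}
    (hζ : ζ ∈ D) {κ κ' : ℂ → ℂ} (h : IsReducedRep D μ m ζ κ) (h' : IsReducedRep D μ m ζ κ') :
    Set.EqOn κ κ' D := by
  have hd := h.1.sub h'.1
  have hd0 : ∀ k < m, iteratedDeriv k (κ - κ') ζ = 0 := fun k hk => by
    rw [iteratedDeriv_sub_of_isOpen hD (h.1.differentiableOn hD) (h'.1.differentiableOn hD) hζ,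
      h.2.1 k hk, h'.2.1 k hk, sub_zero]
  have h1 : weightedNormSq D μ (κ - κ') = 0 := by
    have e1 := h.2.2 _ hd hd0
    have e2 := h'.2.2 _ hd hd0
    have e3 : weightedInner D μ (κ - κ') (κ - κ') = 0 := by
      rw [← conj_weightedInner, weightedInner_sub_left h.1 h'.1 hd,
        ← conj_weightedInner _ κ, ← conj_weightedInner _ κ', ← e1, ← e2]
      simp
    rw [weightedInner_self] at e3
    exact_mod_cast e3
  intro z hz
  obtain ⟨C, -, hC⟩ := hμ.exists_sq_bound_on_compact hD isCompact_singleton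
    (Set.singleton_subset_iff.2 hz)
  have := hC _ hd z rfl
  rw [h1, mul_zero] at this
  have h2 : ‖(κ - κ') z‖ = 0 := by
    have := sq_nonneg ‖(κ - κ') z‖
    exact pow_eq_zero_iff (two_ne_zero) |>.1 (le_antisymm ‹_› this)
  simpa [sub_eq_zero] using h2

/-- Representers of all derivative functionals on the reduced Bergman space; their derivatives
are the mixed derivatives of the kernel. -/
theorem IsAdmissibleWeight.exists_derivRep (hμ : IsAdmissibleWeight D μ) (hD : IsOpen D)
    (hc : IsPreconnected D) :
    ∃ e : ℕ → ℂ → ℂ → ℂ, ∀ k, ∀ w ∈ D, MemReduced D μ (e k w) ∧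
      (∀ h, MemReduced D μ h → iteratedDeriv k h w = weightedInner D μ h (e k w)) ∧
      ∀ j, ∀ z ∈ D, iteratedDeriv j (e k w) z = kernelMixedDeriv D μ j k z w := by
  have hex : ∀ (k : ℕ) (w : ℂ), ∃ e, w ∈ D → MemReduced D μ e ∧
      ∀ h, MemReduced D μ h → iteratedDeriv k h w = weightedInner D μ h e := by
    intro k w
    by_cases hw : w ∈ D
    · obtain ⟨e, he, -, hrep⟩ := hμ.exists_representer hD hc hw 0 k
      exact ⟨e, fun _ => ⟨he, fun h hh => hrep h hh (by simp)⟩⟩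
    · exact ⟨0, fun h => absurd h hw⟩
  choose e he using hex
  refine ⟨e, fun k w hw => ⟨(he k w hw).1, (he k w hw).2, fun j z hz => ?_⟩⟩
  have hK : ∀ ζ ∈ D, MemReduced D μ (fun z => reducedKernel D μ 1 z ζ) ∧
      ∀ h, MemReduced D μ h → h ζ = weightedInner D μ h (fun z => reducedKernel D μ 1 z ζ) :=
    fun ζ hζ => by
      obtain ⟨h1, -, h2⟩ := hμ.isReducedRep hD hc hζ 0
      exact ⟨h1, fun h hh => by simpa using h2 h hh (by simp)⟩
  rw [kernelMixedDeriv]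
  refine iteratedDeriv_congr_of_eqOn hD (fun z' hz' => ?_) hz j
  -- By Hermitian symmetry the inner derivative is that of `K(·, z')` at `w`, namely `⟨K(·, z'), e k
  -- w⟩`. Its conjugate is `e k w` evaluated at `z'`.
  have h1 : Set.EqOn (fun ζ' => conj (reducedKernel D μ 1 z' ζ'))
      (fun ζ' => reducedKernel D μ 1 ζ' z') D := fun ζ' hζ' => by
    have e1 := (hK ζ' hζ').2 _ (hK z' hz').1
    have e2 := (hK z' hz').2 _ (hK ζ' hζ').1
    change conj (reducedKernel D μ 1 z' ζ') = reducedKernel D μ 1 ζ' z'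
    rw [e1, e2, conj_weightedInner]
  rw [iteratedDeriv_congr_of_eqOn hD h1 hw, (he k w hw).2 _ (hK z' hz').1, conj_weightedInner]
  exact (hK z' hz').2 _ (he k w hw).1

/-- Both sides are inner products of the same two representers. This transfers statements about the
first variable to the second. -/
theorem IsAdmissibleWeight.kernelMixedDeriv_symm (hμ : IsAdmissibleWeight D μ) (hD : IsOpen D)
    (hc : IsPreconnected D) (j k : ℕ) {z w : ℂ} (hz : z ∈ D) (hw : w ∈ D) :
    kernelMixedDeriv D μ j k z w = conj (kernelMixedDeriv D μ k j w z) := by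
  obtain ⟨e, he⟩ := hμ.exists_derivRep hD hc
  rw [← (he k w hw).2.2 j z hz, ← (he j z hz).2.2 k w hw, (he j z hz).2.1 _ (he k w hw).1,
    (he k w hw).2.1 _ (he j z hz).1, conj_weightedInner]

theorem IsAdmissibleWeight.hasDerivAt_kernelMixedDeriv (hμ : IsAdmissibleWeight D μ)
    (hD : IsOpen D) (hc : IsPreconnected D) (j k : ℕ) {z w : ℂ} (hz : z ∈ D) (hw : w ∈ D) :
    HasDerivAt (fun z => kernelMixedDeriv D μ j k z w) (kernelMixedDeriv D μ (j + 1) k z w) z := by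
  obtain ⟨e, he⟩ := hμ.exists_derivRep hD hc
  have h1 := (((he k w hw).1.differentiableOn hD).iteratedDeriv_of_isOpen hD j).differentiableAt
    (hD.mem_nhds hz) |>.hasDerivAt
  rw [← iteratedDeriv_succ, (he k w hw).2.2 (j + 1) z hz] at h1
  refine h1.congr_of_eventuallyEq ?_
  filter_upwards [hD.mem_nhds hz] with z' hz' using ((he k w hw).2.2 j z' hz').symm

theorem kernelMixedDeriv_zero_zero (z w : ℂ) :
    kernelMixedDeriv D μ 0 0 z w = reducedKernel D μ 1 z w := by
  simp [kernelMixedDeriv]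

open Matrix in
/-- Cramer's formula for the kernels of order `m + 2`. -/
theorem IsAdmissibleWeight.reducedKernel_eq (hμ : IsAdmissibleWeight D μ) (hD : IsOpen D)
    (hc : IsPreconnected D) (m : ℕ) {z w : ℂ} (hz : z ∈ D) (hw : w ∈ D)
    (hJ : kernelGramDet D μ m w ≠ 0) :
    reducedKernel D μ (m + 2) z w = kernelMixedDeriv D μ 0 (m + 1) z w -
      ∑ k : Fin (m + 1), (∑ l : Fin (m + 1),
        (Matrix.of fun j k : Fin (m + 1) => kernelMixedDeriv D μ j k w w).adjugate k l *
          kernelMixedDeriv D μ l (m + 1) w w) * (kernelGramDet D μ m w)⁻¹ *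
        kernelMixedDeriv D μ 0 k z w := by
  obtain ⟨e, he⟩ := hμ.exists_derivRep hD hc
  set G : Matrix (Fin (m + 1)) (Fin (m + 1)) ℂ :=
    Matrix.of fun j k : Fin (m + 1) => kernelMixedDeriv D μ j k w w with hG
  have hdet : kernelGramDet D μ m w = G.det := rfl
  rw [hdet] at hJ ⊢
  -- Cramer's solution of `G c = b`; these coefficients make the derivatives of orders `0, …, m` at
  -- `w` of `e (m + 1) w - ∑ c k • e k w` vanish.
  set c : Fin (m + 1) → ℂ := fun k => (∑ l : Fin (m + 1),
    G.adjugate k l * kernelMixedDeriv D μ l (m + 1) w w) * G.det⁻¹ with hcdef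
  have hGc : ∀ j : Fin (m + 1), ∑ k, G j k * c k = kernelMixedDeriv D μ j (m + 1) w w := by
    intro j
    set b : Fin (m + 1) → ℂ := fun l => kernelMixedDeriv D μ l (m + 1) w w
    have h1 : c = G.det⁻¹ • (G.adjugate *ᵥ b) := by
      ext k; simp [hcdef, Matrix.mulVec, dotProduct, mul_comm, b]
    have h2 : G *ᵥ c = b := by
      rw [h1, Matrix.mulVec_smul, Matrix.mulVec_mulVec, Matrix.mul_adjugate, Matrix.smul_mulVec,
        Matrix.one_mulVec, smul_smul, inv_mul_cancel₀ hJ, one_smul]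
    exact congrFun h2 j
  have hS : ∀ k : Fin (m + 1), MemReduced D μ (c k • e k w) :=
    fun k => (he k w hw).1.const_smul _
  have hSd : ∀ j, ∀ z ∈ D, iteratedDeriv j (∑ k : Fin (m + 1), c k • e k w) z =
      ∑ k : Fin (m + 1), c k * kernelMixedDeriv D μ j k z w := by
    intro j z hz
    rw [iteratedDeriv_sum fun k _ => (((hS k).differentiableOn hD).contDiffOn hD).contDiffAt
      (hD.mem_nhds hz)]
    refine Finset.sum_congr rfl fun k _ => ?_
    rw [iteratedDeriv_const_smul_of_isOpen hD ((he k w hw).1.differentiableOn hD) _ hz,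
      (he k w hw).2.2 j z hz]
  have he' := he (m + 1) w hw
  have hv := he'.1.sub (MemReduced.sum Finset.univ hS)
  have hvd : ∀ j, ∀ z ∈ D, iteratedDeriv j (e (m + 1) w - ∑ k : Fin (m + 1), c k • e k w) z =
      kernelMixedDeriv D μ j (m + 1) z w -
        ∑ k : Fin (m + 1), c k * kernelMixedDeriv D μ j k z w := by
    intro j z hz
    rw [iteratedDeriv_sub_of_isOpen hD (he'.1.differentiableOn hD)
      ((MemReduced.sum Finset.univ hS).differentiableOn hD) hz, hSd j z hz, he'.2.2 j z hz]
  have hrep : IsReducedRep D μ (m + 1) w (e (m + 1) w - ∑ k : Fin (m + 1), c k • e k w) := by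
    refine ⟨hv, fun j hj => ?_, fun h hh h0 => ?_⟩
    · rw [hvd j w hw, ← hGc ⟨j, hj⟩, sub_eq_zero]
      exact Finset.sum_congr rfl fun k _ => mul_comm _ _
    -- A test function with vanishing derivatives up to order `m` is orthogonal to every `e k w`
    -- with `k ≤ m`, so the correction does not affect the representation.
    · have h1 : weightedInner D μ (∑ k : Fin (m + 1), c k • e k w) h = 0 := by
        rw [weightedInner_sum_left _ hS hh]
        refine Finset.sum_eq_zero fun k _ => ?_
        rw [weightedInner_smul_left (he k w hw).1 hh, ← conj_weightedInner,
          ← (he k w hw).2.1 h hh, h0 k k.2]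
        simp
      rw [← conj_weightedInner, weightedInner_sub_left he'.1 (MemReduced.sum Finset.univ hS) hh,
        h1, sub_zero, conj_weightedInner, he'.2.1 h hh]
  have h1 := (hμ.isReducedRep hD hc hw (m + 1)).eqOn hμ hD hw hrep hz
  have h2 := hvd 0 z hz
  simp only [iteratedDeriv_zero] at h2
  rw [h2] at h1
  exact h1

end Kernels

/-! ### A calculus for convergence of derivatives -/

section SmoothTendsto

variable {ι E : Type*} [Fintype ι] [NormedAddCommGroup E] [NormedSpace ℝ E]
  {𝔸 : Type*} [NontriviallyNormedField 𝔸] [NormedAlgebra ℝ 𝔸]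

/-- The linear combination of the covectors `ℓ a` with coefficients `c a`. -/
noncomputable def covectorSum (ℓ : ι → E →L[ℝ] 𝔸) (c : ι → 𝔸) : E →L[ℝ] 𝔸 := ∑ a, c a • ℓ a

theorem covectorSum_apply (ℓ : ι → E →L[ℝ] 𝔸) (c : ι → 𝔸) (v : E) :
    covectorSum ℓ c v = ∑ a, c a * ℓ a v := by
  simp [covectorSum]

theorem covectorSum_zero (ℓ : ι → E →L[ℝ] 𝔸) : covectorSum ℓ (fun _ => 0) = 0 := by
  ext v; simp [covectorSum_apply]

theorem covectorSum_add (ℓ : ι → E →L[ℝ] 𝔸) (c d : ι → 𝔸) :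
    covectorSum ℓ (fun a => c a + d a) = covectorSum ℓ c + covectorSum ℓ d := by
  ext v; simp [covectorSum_apply, add_mul, Finset.sum_add_distrib]

theorem covectorSum_mul (ℓ : ι → E →L[ℝ] 𝔸) (c : ι → 𝔸) (b : 𝔸) :
    covectorSum ℓ (fun a => b * c a) = b • covectorSum ℓ c := by
  ext v; simp [covectorSum_apply, Finset.mul_sum, mul_assoc]

/-- Convergence of order `m` of a sequence of functions at `p`, uniform near `p` in the sense of
the filter `atTop ×ˢ 𝓝 p`, for functions with differentials in the span of fixed covectors. -/
def SmoothTendsto (ℓ : ι → E →L[ℝ] 𝔸) (p : E) : ℕ → (ℕ → E → 𝔸) → (E → 𝔸) → Prop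
  | 0, F, f => Tendsto (fun x : ℕ × E => F x.1 x.2) (atTop ×ˢ 𝓝 p) (𝓝 (f p))
  | m + 1, F, f => Tendsto (fun x : ℕ × E => F x.1 x.2) (atTop ×ˢ 𝓝 p) (𝓝 (f p)) ∧
      ∃ (F' : ι → ℕ → E → 𝔸) (f' : ι → E → 𝔸),
        (∀ᶠ x : ℕ × E in atTop ×ˢ 𝓝 p,
          HasFDerivAt (F x.1) (covectorSum ℓ fun a => F' a x.1 x.2) x.2) ∧
        (∀ᶠ q in 𝓝 p, HasFDerivAt f (covectorSum ℓ fun a => f' a q) q) ∧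
        ∀ a, SmoothTendsto ℓ p m (F' a) (f' a)

theorem eventually_prod_nhds_nhds {E : Type*} [TopologicalSpace E] {p : E} {P : ℕ → E → Prop}
    (h : ∀ᶠ x : ℕ × E in atTop ×ˢ 𝓝 p, P x.1 x.2) :
    ∀ᶠ x : ℕ × E in atTop ×ˢ 𝓝 p, ∀ᶠ q in 𝓝 x.2, P x.1 q := by
  obtain ⟨pa, ha, pb, hb, H⟩ := eventually_prod_iff.1 h
  exact eventually_prod_iff.2 ⟨pa, ha, _, eventually_eventually_nhds.2 hb,
    fun hx y hy => hy.mono fun q hq => H hx hq⟩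

variable {ℓ : ι → E →L[ℝ] 𝔸} {p : E}

theorem SmoothTendsto.tendsto {m : ℕ} {F : ℕ → E → 𝔸} {f : E → 𝔸} (h : SmoothTendsto ℓ p m F f) :
    Tendsto (fun x : ℕ × E => F x.1 x.2) (atTop ×ˢ 𝓝 p) (𝓝 (f p)) := by
  cases m with
  | zero => exact h
  | succ m => exact h.1

/-- The product and inverse rules contain undifferentiated factors, which the induction needs at the
lower order. -/
theorem SmoothTendsto.of_succ {m : ℕ} {F : ℕ → E → 𝔸} {f : E → 𝔸}
    (h : SmoothTendsto ℓ p (m + 1) F f) : SmoothTendsto ℓ p m F f := by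
  induction m generalizing F f with
  | zero => exact h.1
  | succ m ih =>
    obtain ⟨h0, F', f', h1, h2, h3⟩ := h
    exact ⟨h0, F', f', h1, h2, fun a => ih (h3 a)⟩

theorem SmoothTendsto.congr {m : ℕ} {F G : ℕ → E → 𝔸} {f g : E → 𝔸}
    (h : SmoothTendsto ℓ p m F f)
    (hF : ∀ᶠ x : ℕ × E in atTop ×ˢ 𝓝 p, F x.1 x.2 = G x.1 x.2) (hf : f =ᶠ[𝓝 p] g) :
    SmoothTendsto ℓ p m G g := by
  have h0 : Tendsto (fun x : ℕ × E => G x.1 x.2) (atTop ×ˢ 𝓝 p) (𝓝 (g p)) := by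
    rw [← hf.eq_of_nhds]
    exact h.tendsto.congr' hF
  cases m with
  | zero => exact h0
  | succ m =>
    obtain ⟨-, F', f', h1, h2, h3⟩ := h
    refine ⟨h0, F', f', ?_, ?_, h3⟩
    · filter_upwards [h1, eventually_prod_nhds_nhds (P := fun i q => F i q = G i q) hF] with x hx hx'
      exact hx.congr_of_eventuallyEq (hx'.mono fun q hq => hq.symm)
    · filter_upwards [h2, eventually_eventually_nhds.2 hf] with q hq hq'
      exact hq.congr_of_eventuallyEq (hq'.mono fun q hq => hq.symm)

theorem SmoothTendsto.const (m : ℕ) (c : 𝔸) :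
    SmoothTendsto ℓ p m (fun _ _ => c) (fun _ => c) := by
  induction m generalizing c with
  | zero => exact tendsto_const_nhds
  | succ m ih =>
    refine ⟨tendsto_const_nhds, fun _ _ _ => 0, fun _ _ => 0, ?_, ?_, fun a => ih 0⟩
    · refine Eventually.of_forall fun x => ?_
      rw [covectorSum_zero]
      exact hasFDerivAt_const (𝕜 := ℝ) c x.2
    · refine Eventually.of_forall fun x => ?_
      rw [covectorSum_zero]
      exact hasFDerivAt_const (𝕜 := ℝ) c x

theorem SmoothTendsto.add {m : ℕ} {F G : ℕ → E → 𝔸} {f g : E → 𝔸}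
    (hF : SmoothTendsto ℓ p m F f) (hG : SmoothTendsto ℓ p m G g) :
    SmoothTendsto ℓ p m (fun i q => F i q + G i q) (fun q => f q + g q) := by
  induction m generalizing F G f g with
  | zero => exact Tendsto.add hF hG
  | succ m ih =>
    obtain ⟨h0, F', f', h1, h2, h3⟩ := hF
    obtain ⟨k0, G', g', k1, k2, k3⟩ := hG
    refine ⟨h0.add k0, fun a i q => F' a i q + G' a i q, fun a q => f' a q + g' a q, ?_, ?_,
      fun a => ih (h3 a) (k3 a)⟩
    · filter_upwards [h1, k1] with x hx kx
      rw [covectorSum_add]; exact hx.fun_add kx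
    · filter_upwards [h2, k2] with x hx kx
      rw [covectorSum_add]; exact hx.fun_add kx

theorem SmoothTendsto.mul {m : ℕ} {F G : ℕ → E → 𝔸} {f g : E → 𝔸}
    (hF : SmoothTendsto ℓ p m F f) (hG : SmoothTendsto ℓ p m G g) :
    SmoothTendsto ℓ p m (fun i q => F i q * G i q) (fun q => f q * g q) := by
  induction m generalizing F G f g with
  | zero => exact Tendsto.mul hF hG
  | succ m ih =>
    have hF' := hF.of_succ
    have hG' := hG.of_succ
    obtain ⟨h0, F', f', h1, h2, h3⟩ := hF
    obtain ⟨k0, G', g', k1, k2, k3⟩ := hG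
    refine ⟨h0.mul k0, fun a i q => F i q * G' a i q + G i q * F' a i q,
      fun a q => f q * g' a q + g q * f' a q, ?_, ?_,
      fun a => (ih hF' (k3 a)).add (ih hG' (h3 a))⟩
    · filter_upwards [h1, k1] with x hx kx
      rw [covectorSum_add, covectorSum_mul, covectorSum_mul]; exact hx.fun_mul kx
    · filter_upwards [h2, k2] with x hx kx
      rw [covectorSum_add, covectorSum_mul, covectorSum_mul]; exact hx.fun_mul kx

theorem SmoothTendsto.inv {m : ℕ} {F : ℕ → E → 𝔸} {f : E → 𝔸}
    (hF : SmoothTendsto ℓ p m F f) (hp : f p ≠ 0) :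
    SmoothTendsto ℓ p m (fun i q => (F i q)⁻¹) (fun q => (f q)⁻¹) := by
  induction m with
  | zero => exact Tendsto.inv₀ hF hp
  | succ m ih =>
    have hinv := ih hF.of_succ
    obtain ⟨h0, F', f', h1, h2, h3⟩ := hF
    -- The derivative is written with constants, products and inverses only, so that the induction
    -- hypothesis applies to it.
    have hd : ∀ z : 𝔸, z ≠ 0 → HasDerivAt (fun z : 𝔸 => z⁻¹) (-1 * (z⁻¹ * z⁻¹)) z := fun z hz => by
      have := hasDerivAt_inv hz
      rwa [sq, mul_inv, ← neg_one_mul] at this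
    refine ⟨h0.inv₀ hp, fun a i q => (-1 * ((F i q)⁻¹ * (F i q)⁻¹)) * F' a i q,
      fun a q => (-1 * ((f q)⁻¹ * (f q)⁻¹)) * f' a q, ?_, ?_,
      fun a => ((SmoothTendsto.const m (-1)).mul (hinv.mul hinv)).mul (h3 a)⟩
    · filter_upwards [h1, h0.eventually_ne hp] with x hx hx0
      rw [covectorSum_mul]; exact (hd _ hx0).comp_hasFDerivAt x.2 hx
    · have hfc : ContinuousAt f p := h2.self_of_nhds.continuousAt
      filter_upwards [h2, hfc.eventually_ne hp] with x hx hx0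
      rw [covectorSum_mul]; exact (hd _ hx0).comp_hasFDerivAt x hx

theorem SmoothTendsto.sum {κ : Type*} (s : Finset κ) {m : ℕ} {F : κ → ℕ → E → 𝔸} {f : κ → E → 𝔸}
    (h : ∀ a, SmoothTendsto ℓ p m (F a) (f a)) :
    SmoothTendsto ℓ p m (fun i q => ∑ a ∈ s, F a i q) (fun q => ∑ a ∈ s, f a q) := by
  classical
  induction s using Finset.induction_on with
  | empty => simpa using SmoothTendsto.const m 0
  | insert a s ha ih => simpa only [Finset.sum_insert ha] using (h a).add ih

theorem SmoothTendsto.prod {κ : Type*} (s : Finset κ) {m : ℕ} {F : κ → ℕ → E → 𝔸} {f : κ → E → 𝔸}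
    (h : ∀ a, SmoothTendsto ℓ p m (F a) (f a)) :
    SmoothTendsto ℓ p m (fun i q => ∏ a ∈ s, F a i q) (fun q => ∏ a ∈ s, f a q) := by
  classical
  induction s using Finset.induction_on with
  | empty => simpa using SmoothTendsto.const m 1
  | insert a s ha ih => simpa only [Finset.prod_insert ha] using (h a).mul ih

theorem SmoothTendsto.det {κ : Type*} [Fintype κ] [DecidableEq κ] {m : ℕ}
    {A : ℕ → E → Matrix κ κ 𝔸} {B : E → Matrix κ κ 𝔸}
    (h : ∀ j k, SmoothTendsto ℓ p m (fun i q => A i q j k) (fun q => B q j k)) :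
    SmoothTendsto ℓ p m (fun i q => (A i q).det) (fun q => (B q).det) := by
  simp only [Matrix.det_apply']
  exact SmoothTendsto.sum _ fun σ =>
    (SmoothTendsto.const m _).mul (SmoothTendsto.prod _ fun j => h _ _)

/-- An adjugate entry is the determinant after one row is replaced by a constant unit vector. -/
theorem SmoothTendsto.adjugate {κ : Type*} [Fintype κ] [DecidableEq κ] {m : ℕ}
    {A : ℕ → E → Matrix κ κ 𝔸} {B : E → Matrix κ κ 𝔸}
    (h : ∀ j k, SmoothTendsto ℓ p m (fun i q => A i q j k) (fun q => B q j k)) (j k : κ) :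
    SmoothTendsto ℓ p m (fun i q => (A i q).adjugate j k) (fun q => (B q).adjugate j k) := by
  simp only [Matrix.adjugate_apply]
  refine SmoothTendsto.det fun a b => ?_
  by_cases ha : a = k
  · subst ha
    simpa only [Matrix.updateRow_self] using SmoothTendsto.const m _
  · simpa only [Matrix.updateRow_ne ha] using h a b

/-- Fixed linear maps applied to scalar coefficients: derivatives of the differential reduce to
derivatives of the coefficients. -/
theorem covectorSum_eq_sum_comp (f' : ι → E → 𝔸) :
    (fun x => covectorSum ℓ fun a => f' a x) =
      ∑ a, ((ContinuousLinearMap.toSpanSingleton 𝔸 (ℓ a)).restrictScalars ℝ) ∘ f' a := by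
  ext x v
  simp [covectorSum_apply]

theorem contDiffAt_covectorSum {m : ℕ} {f' : ι → E → 𝔸} {q : E}
    (h : ∀ a, ContDiffAt ℝ m (f' a) q) :
    ContDiffAt ℝ m (fun x => covectorSum ℓ fun a => f' a x) q := by
  rw [covectorSum_eq_sum_comp, Finset.sum_fn]
  exact ContDiffAt.sum fun a _ => (ContinuousLinearMap.contDiff _).contDiffAt.comp q (h a)

/-- One order is lost: `SmoothTendsto` of order `0` says nothing about `f` away from `p`, and
continuity near `p` comes from the differential at order `1`. -/
theorem SmoothTendsto.contDiffAt {m : ℕ} {F : ℕ → E → 𝔸} {f : E → 𝔸}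
    (h : SmoothTendsto ℓ p (m + 1) F f) : ContDiffAt ℝ m f p := by
  induction m generalizing F f with
  | zero =>
    obtain ⟨-, F', f', -, h2, -⟩ := h
    exact contDiffAt_zero.2 ⟨_, h2, fun q hq => hq.continuousAt.continuousWithinAt⟩
  | succ m ih =>
    obtain ⟨-, F', f', -, h2, h3⟩ := h
    exact contDiffAt_succ_iff_hasFDerivAt.2 ⟨_, ⟨_, h2, fun q hq => hq⟩,
      contDiffAt_covectorSum fun a => ih (h3 a)⟩

theorem SmoothTendsto.eventually_contDiffAt {m : ℕ} {F : ℕ → E → 𝔸} {f : E → 𝔸}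
    (h : SmoothTendsto ℓ p (m + 1) F f) :
    ∀ᶠ x : ℕ × E in atTop ×ˢ 𝓝 p, ContDiffAt ℝ m (F x.1) x.2 := by
  induction m generalizing F f with
  | zero =>
    obtain ⟨-, F', f', h1, -, -⟩ := h
    filter_upwards [eventually_prod_nhds_nhds
        (P := fun i q => HasFDerivAt (F i) (covectorSum ℓ fun a => F' a i q) q) h1] with x hx
    exact contDiffAt_zero.2 ⟨_, hx, fun q hq => hq.continuousAt.continuousWithinAt⟩
  | succ m ih =>
    obtain ⟨-, F', f', h1, -, h3⟩ := h
    filter_upwards [eventually_prod_nhds_nhds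
        (P := fun i q => HasFDerivAt (F i) (covectorSum ℓ fun a => F' a i q) q) h1,
      eventually_all.2 fun a => ih (h3 a)] with x hx hx'
    exact contDiffAt_succ_iff_hasFDerivAt.2 ⟨_, ⟨_, hx, fun q hq => hq⟩,
      contDiffAt_covectorSum hx'⟩

theorem iteratedFDeriv_succ_of_hasFDerivAt_sum {m : ℕ} {f : E → 𝔸} {f' : ι → E → 𝔸} {q : E}
    (h : ∀ᶠ x in 𝓝 q, HasFDerivAt f (covectorSum ℓ fun a => f' a x) x)
    (hf' : ∀ a, ContDiffAt ℝ m (f' a) q) :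
    iteratedFDeriv ℝ (m + 1) f q = (continuousMultilinearCurryRightEquiv' ℝ m E 𝔸).symm
      (∑ a, ((ContinuousLinearMap.toSpanSingleton 𝔸 (ℓ a)).restrictScalars
        ℝ).compContinuousMultilinearMap (iteratedFDeriv ℝ m (f' a) q)) := by
  have h1 : iteratedFDeriv ℝ (m + 1) f q =
      (continuousMultilinearCurryRightEquiv' ℝ m E 𝔸).symm (iteratedFDeriv ℝ m (fderiv ℝ f) q) := by
    rw [iteratedFDeriv_succ_eq_comp_right]; rfl
  rw [h1]
  congr 1
  have h2 : fderiv ℝ f =ᶠ[𝓝 q] fun x => covectorSum ℓ fun a => f' a x :=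
    h.mono fun x hx => hx.fderiv
  rw [(Filter.EventuallyEq.iteratedFDeriv ℝ h2 m).eq_of_nhds, covectorSum_eq_sum_comp,
    iteratedFDeriv_sum_apply fun a _ =>
      (ContinuousLinearMap.contDiff _).contDiffAt.comp q (hf' a)]
  exact Finset.sum_congr rfl fun a _ =>
    ContinuousLinearMap.iteratedFDeriv_comp_left _ (hf' a) le_rfl

theorem SmoothTendsto.tendsto_iteratedFDeriv {m : ℕ} {F : ℕ → E → 𝔸} {f : E → 𝔸}
    (h : SmoothTendsto ℓ p (m + 1) F f) :
    Tendsto (fun x : ℕ × E => iteratedFDeriv ℝ m (F x.1) x.2) (atTop ×ˢ 𝓝 p)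
      (𝓝 (iteratedFDeriv ℝ m f p)) := by
  induction m generalizing F f with
  | zero =>
    simp only [iteratedFDeriv_zero_eq_comp]
    exact ((continuousMultilinearCurryFin0 ℝ E 𝔸).symm.continuous.tendsto _).comp h.1
  | succ m ih =>
    obtain ⟨-, F', f', h1, h2, h3⟩ := h
    rw [iteratedFDeriv_succ_of_hasFDerivAt_sum h2 fun a => (h3 a).contDiffAt]
    have hev : ∀ᶠ x : ℕ × E in atTop ×ˢ 𝓝 p,
        (continuousMultilinearCurryRightEquiv' ℝ m E 𝔸).symm
          (∑ a, ((ContinuousLinearMap.toSpanSingleton 𝔸 (ℓ a)).restrictScalars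
            ℝ).compContinuousMultilinearMap (iteratedFDeriv ℝ m (F' a x.1) x.2)) =
        iteratedFDeriv ℝ (m + 1) (F x.1) x.2 := by
      filter_upwards [eventually_prod_nhds_nhds
        (P := fun i q => HasFDerivAt (F i) (covectorSum ℓ fun a => F' a i q) q) h1,
        eventually_all.2 fun a => (h3 a).eventually_contDiffAt] with x hx hx'
      exact (iteratedFDeriv_succ_of_hasFDerivAt_sum hx hx').symm
    refine Tendsto.congr' hev ?_
    refine ((continuousMultilinearCurryRightEquiv' ℝ m E 𝔸).symm.continuous.tendsto _).comp ?_
    refine tendsto_finsetSum _ fun a _ => ?_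
    exact ((ContinuousLinearMap.compContinuousMultilinearMapL ℝ (fun _ : Fin m => E) 𝔸 _
      _).continuous.tendsto _).comp (ih (h3 a))

end SmoothTendsto

/-! ### Kernels that converge pointwise with local bounds -/

theorem tendstoLocallyUniformlyOn_of_forall_tendsto_prod {X Y : Type*} [TopologicalSpace X]
    [PseudoMetricSpace Y] {F : ℕ → X → Y} {f : X → Y} {U : Set X} (hf : ContinuousOn f U)
    (h : ∀ p ∈ U, Tendsto (fun x : ℕ × X => F x.1 x.2) (atTop ×ˢ 𝓝 p) (𝓝 (f p))) :
    TendstoLocallyUniformlyOn F f atTop U := by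
  rw [tendstoLocallyUniformlyOn_iff_forall_tendsto]
  intro p hp
  have h1 : Tendsto (fun x : ℕ × X => f x.2) (atTop ×ˢ 𝓝[U] p) (𝓝 (f p)) :=
    (hf p hp).tendsto.comp tendsto_snd
  have h2 : Tendsto (fun x : ℕ × X => F x.1 x.2) (atTop ×ˢ 𝓝[U] p) (𝓝 (f p)) :=
    (h p hp).mono_left (Filter.prod_mono le_rfl nhdsWithin_le_nhds)
  exact (h1.prodMk_nhds h2).mono_right (nhds_le_uniformity _)

/-- With a Lipschitz constant independent of the index, convergence at the single point `p` already
gives joint convergence near it. -/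
theorem tendsto_prod_nhds_of_lipschitz {X Y : Type*} [PseudoMetricSpace X] [PseudoMetricSpace Y]
    {F : ℕ → X → Y} {p : X} {y : Y} (C : ℝ) (hp : Tendsto (fun i => F i p) atTop (𝓝 y))
    (hF : ∀ᶠ x : ℕ × X in atTop ×ˢ 𝓝 p, dist (F x.1 x.2) (F x.1 p) ≤ C * dist x.2 p) :
    Tendsto (fun x : ℕ × X => F x.1 x.2) (atTop ×ˢ 𝓝 p) (𝓝 y) := by
  rw [tendsto_iff_dist_tendsto_zero] at hp ⊢
  have h2 : Tendsto (fun x : ℕ × X => C * dist x.2 p + dist (F x.1 p) y) (atTop ×ˢ 𝓝 p) (𝓝 0) := by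
    have h3 : Tendsto (fun x : ℕ × X => dist x.2 p) (atTop ×ˢ 𝓝 p) (𝓝 0) :=
      (tendsto_iff_dist_tendsto_zero.1 tendsto_id).comp tendsto_snd
    simpa using (h3.const_mul C).add (hp.comp tendsto_fst)
  refine squeeze_zero' (Eventually.of_forall fun _ => dist_nonneg) ?_ h2
  filter_upwards [hF] with x hx
  exact (dist_triangle _ (F x.1 p) _).trans (by gcongr)

/-- Locally bounded pointwise convergence of reduced Bergman kernels of domains `D i` which
eventually contain every compact subset of `Ω`. -/
structure KernelConvergence (D : ℕ → Set ℂ) (μ : ℕ → ℂ → ℝ) (Ω : Set ℂ) (ν : ℂ → ℝ) : Prop where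
  isOpen : ∀ i, IsOpen (D i)
  isPreconnected : ∀ i, IsPreconnected (D i)
  admissible : ∀ i, IsAdmissibleWeight (D i) (μ i)
  isOpen_lim : IsOpen Ω
  isPreconnected_lim : IsPreconnected Ω
  admissible_lim : IsAdmissibleWeight Ω ν
  bound : ∀ L ⊆ Ω, IsCompact L → ∃ C : ℝ, ∀ᶠ i in atTop, L ⊆ D i ∧
    ∀ z ∈ L, ∀ w ∈ L, ‖reducedKernel (D i) (μ i) 1 z w‖ ≤ C
  tendsto : ∀ z ∈ Ω, ∀ w ∈ Ω, Tendsto (fun i => reducedKernel (D i) (μ i) 1 z w) atTop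
    (𝓝 (reducedKernel Ω ν 1 z w))

section Single

variable {D : Set ℂ} {μ : ℂ → ℝ}

/-- With `N = K(w, w) = ‖K(·, w)‖²`, evaluation at `w` gives `N² ≤ C N`, so `N ≤ C`; evaluation at
`z` then gives `|K(z, w)|² ≤ C N ≤ C²`. -/
theorem norm_reducedKernel_le (hμ : IsAdmissibleWeight D μ) (hD : IsOpen D)
    (hc : IsPreconnected D) {L : Set ℂ} (hL : L ⊆ D) {C : ℝ} (hC0 : 0 ≤ C)
    (hC : ∀ h, MemReduced D μ h → ∀ z ∈ L, ‖h z‖ ^ 2 ≤ C * weightedNormSq D μ h)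
    {z w : ℂ} (hz : z ∈ L) (hw : w ∈ L) : ‖reducedKernel D μ 1 z w‖ ≤ C := by
  have hκ := hμ.isReducedRep hD hc (hL hw) 0
  have h1 := hκ.iteratedDeriv_self
  simp only [iteratedDeriv_zero] at h1
  have h2 := hC _ hκ.1 w hw
  have h3 := hC _ hκ.1 z hz
  simp only [zero_add] at h1 h2 h3
  rw [h1] at h2
  set N := weightedNormSq D μ fun z => reducedKernel D μ 1 z w with hN
  have hN0 : 0 ≤ N := weightedNormSq_nonneg _
  have h4 : N ≤ C := by
    rw [Complex.norm_real, Real.norm_of_nonneg hN0] at h2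
    rcases hN0.eq_or_lt with h | h
    · rw [← h]; exact hC0
    · nlinarith
  refine abs_le_of_sq_le_sq' ?_ hC0 |>.2
  nlinarith

theorem IsAdmissibleWeight.norm_kernelMixedDeriv_sub_le (hμ : IsAdmissibleWeight D μ)
    (hD : IsOpen D) (hc : IsPreconnected D) {j k : ℕ} {c w : ℂ} {r C : ℝ}
    (hb : Metric.ball c r ⊆ D) (hw : w ∈ D)
    (hC : ∀ z ∈ Metric.ball c r, ‖kernelMixedDeriv D μ (j + 1) k z w‖ ≤ C) {z z' : ℂ}
    (hz : z ∈ Metric.ball c r) (hz' : z' ∈ Metric.ball c r) :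
    ‖kernelMixedDeriv D μ j k z w - kernelMixedDeriv D μ j k z' w‖ ≤ C * ‖z - z'‖ :=
  (convex_ball c r).norm_image_sub_le_of_norm_hasDerivWithin_le
    (fun _ hx => (hμ.hasDerivAt_kernelMixedDeriv hD hc j k (hb hx) hw).hasDerivWithinAt) hC hz' hz

/-- Constant sequences let continuity and smoothness of a single kernel be read off from the
convergence theory. -/
theorem IsAdmissibleWeight.kernelConvergence_const (hμ : IsAdmissibleWeight D μ)
    (hD : IsOpen D) (hc : IsPreconnected D) :
    KernelConvergence (fun _ => D) (fun _ => μ) D μ where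
  isOpen _ := hD
  isPreconnected _ := hc
  admissible _ := hμ
  isOpen_lim := hD
  isPreconnected_lim := hc
  admissible_lim := hμ
  bound L hLD hL := by
    obtain ⟨C, hC0, hC⟩ := hμ.exists_sq_bound_on_compact hD hL hLD
    exact ⟨C, Eventually.of_forall fun i => ⟨hLD, fun z hz w hw =>
      norm_reducedKernel_le hμ hD hc hLD hC0 hC hz hw⟩⟩
  tendsto _ _ _ _ := tendsto_const_nhds

end Single

namespace KernelConvergence

variable {D : ℕ → Set ℂ} {μ : ℕ → ℂ → ℝ} {Ω : Set ℂ} {ν : ℂ → ℝ}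

/-- Cauchy's estimate on a slightly thickened compact set raises the order in `z` by one; symmetry
does the same for the other variable. -/
theorem bound_kernelMixedDeriv (H : KernelConvergence D μ Ω ν) (j k : ℕ) :
    ∀ L ⊆ Ω, IsCompact L → ∃ C : ℝ, ∀ᶠ i in atTop, L ⊆ D i ∧
      ∀ z ∈ L, ∀ w ∈ L, ‖kernelMixedDeriv (D i) (μ i) j k z w‖ ≤ C := by
  have hsymm : ∀ j k, (∀ L ⊆ Ω, IsCompact L → ∃ C : ℝ, ∀ᶠ i in atTop, L ⊆ D i ∧
      ∀ z ∈ L, ∀ w ∈ L, ‖kernelMixedDeriv (D i) (μ i) j k z w‖ ≤ C) →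
      (∀ L ⊆ Ω, IsCompact L → ∃ C : ℝ, ∀ᶠ i in atTop, L ⊆ D i ∧
      ∀ z ∈ L, ∀ w ∈ L, ‖kernelMixedDeriv (D i) (μ i) k j z w‖ ≤ C) := by
    intro j k h L hLΩ hL
    obtain ⟨C, hC⟩ := h L hLΩ hL
    refine ⟨C, hC.mono fun i hi => ⟨hi.1, fun z hz w hw => ?_⟩⟩
    rw [(H.admissible i).kernelMixedDeriv_symm (H.isOpen i) (H.isPreconnected i) _ _
      (hi.1 hz) (hi.1 hw), RCLike.norm_conj]
    exact hi.2 w hw z hz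
  have hsucc : ∀ j k, (∀ L ⊆ Ω, IsCompact L → ∃ C : ℝ, ∀ᶠ i in atTop, L ⊆ D i ∧
      ∀ z ∈ L, ∀ w ∈ L, ‖kernelMixedDeriv (D i) (μ i) j k z w‖ ≤ C) →
      (∀ L ⊆ Ω, IsCompact L → ∃ C : ℝ, ∀ᶠ i in atTop, L ⊆ D i ∧
      ∀ z ∈ L, ∀ w ∈ L, ‖kernelMixedDeriv (D i) (μ i) (j + 1) k z w‖ ≤ C) := by
    intro j k h L hLΩ hL
    obtain ⟨δ, hδ, hδΩ⟩ := hL.exists_cthickening_subset_open H.isOpen_lim hLΩ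
    obtain ⟨C, hC⟩ := h _ hδΩ hL.cthickening
    refine ⟨C / δ, hC.mono fun i hi => ?_⟩
    have hLδ : L ⊆ Metric.cthickening δ L := Metric.self_subset_cthickening L
    refine ⟨hLδ.trans hi.1, fun z hz w hw => ?_⟩
    have hball : Metric.closedBall z δ ⊆ Metric.cthickening δ L :=
      Metric.closedBall_subset_cthickening hz δ
    have hder := fun x (hx : x ∈ D i) => (H.admissible i).hasDerivAt_kernelMixedDeriv
      (H.isOpen i) (H.isPreconnected i) j k hx (hi.1 (hLδ hw))
    rw [← (hder z (hi.1 (hLδ hz))).deriv]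
    refine Complex.norm_deriv_le_of_forall_mem_sphere_norm_le hδ
      (DifferentiableOn.diffContOnCl_ball (fun x hx =>
        (hder x hx).differentiableAt.differentiableWithinAt) (hball.trans hi.1))
      fun x hx => hi.2 x (hball (Metric.sphere_subset_closedBall hx)) w (hLδ hw)
  have h0 : ∀ k, ∀ L ⊆ Ω, IsCompact L → ∃ C : ℝ, ∀ᶠ i in atTop, L ⊆ D i ∧
      ∀ z ∈ L, ∀ w ∈ L, ‖kernelMixedDeriv (D i) (μ i) k 0 z w‖ ≤ C := by
    intro k
    induction k with
    | zero => simpa only [kernelMixedDeriv_zero_zero] using H.bound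
    | succ k ih => exact hsucc _ _ ih
  induction j with
  | zero => exact hsymm _ _ (h0 k)
  | succ j ih => exact hsucc _ _ ih

theorem tendsto_kernelMixedDeriv_prod_fst (H : KernelConvergence D μ Ω ν) {j k : ℕ} {z w : ℂ}
    (hz : z ∈ Ω) (hw : w ∈ Ω)
    (h : Tendsto (fun i => kernelMixedDeriv (D i) (μ i) j k z w) atTop
      (𝓝 (kernelMixedDeriv Ω ν j k z w))) :
    Tendsto (fun x : ℕ × ℂ => kernelMixedDeriv (D x.1) (μ x.1) j k x.2 w) (atTop ×ˢ 𝓝 z)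
      (𝓝 (kernelMixedDeriv Ω ν j k z w)) := by
  obtain ⟨r, hr, hb⟩ := Metric.nhds_basis_closedBall.mem_iff.1 (H.isOpen_lim.mem_nhds hz)
  obtain ⟨C, hC⟩ := H.bound_kernelMixedDeriv (j + 1) k (Metric.closedBall z r ∪ {w})
    (Set.union_subset hb (Set.singleton_subset_iff.2 hw))
    ((isCompact_closedBall z r).union isCompact_singleton)
  refine tendsto_prod_nhds_of_lipschitz
    (F := fun i x => kernelMixedDeriv (D i) (μ i) j k x w) C h ?_
  filter_upwards [prod_mem_prod hC (Metric.ball_mem_nhds z hr)] with x ⟨hx1, hx2⟩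
  rw [dist_eq_norm, dist_eq_norm]
  exact (H.admissible x.1).norm_kernelMixedDeriv_sub_le (H.isOpen _) (H.isPreconnected _)
    (Metric.ball_subset_closedBall.trans (Set.subset_union_left.trans hx1.1)) (hx1.1 (by simp))
    (fun y hy => hx1.2 y (Or.inl (Metric.ball_subset_closedBall hy)) w (by simp))
    hx2 (Metric.mem_ball_self hr)

/-- Bounds on the next derivative make the convergence locally uniform in `z`, and Weierstrass'
theorem then allows differentiation; symmetry handles the other index. -/
theorem tendsto_kernelMixedDeriv (H : KernelConvergence D μ Ω ν) (j k : ℕ) :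
    ∀ z ∈ Ω, ∀ w ∈ Ω, Tendsto (fun i => kernelMixedDeriv (D i) (μ i) j k z w) atTop
      (𝓝 (kernelMixedDeriv Ω ν j k z w)) := by
  have hmem : ∀ z ∈ Ω, ∀ᶠ i in atTop, z ∈ D i := fun z hz => by
    obtain ⟨C, hC⟩ := H.bound {z} (Set.singleton_subset_iff.2 hz) isCompact_singleton
    exact hC.mono fun i hi => hi.1 rfl
  have hsymm : ∀ j k, (∀ z ∈ Ω, ∀ w ∈ Ω, Tendsto (fun i => kernelMixedDeriv (D i) (μ i) j k z w)
      atTop (𝓝 (kernelMixedDeriv Ω ν j k z w))) →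
      ∀ z ∈ Ω, ∀ w ∈ Ω, Tendsto (fun i => kernelMixedDeriv (D i) (μ i) k j z w)
      atTop (𝓝 (kernelMixedDeriv Ω ν k j z w)) := by
    intro j k h z hz w hw
    rw [H.admissible_lim.kernelMixedDeriv_symm H.isOpen_lim H.isPreconnected_lim k j hz hw]
    refine ((Complex.continuous_conj.tendsto _).comp (h w hw z hz)).congr' ?_
    filter_upwards [hmem z hz, hmem w hw] with i hiz hiw
    exact ((H.admissible i).kernelMixedDeriv_symm (H.isOpen i) (H.isPreconnected i) k j
      hiz hiw).symm
  have hsucc : ∀ j k, (∀ z ∈ Ω, ∀ w ∈ Ω, Tendsto (fun i => kernelMixedDeriv (D i) (μ i) j k z w)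
      atTop (𝓝 (kernelMixedDeriv Ω ν j k z w))) →
      ∀ z ∈ Ω, ∀ w ∈ Ω, Tendsto (fun i => kernelMixedDeriv (D i) (μ i) (j + 1) k z w)
      atTop (𝓝 (kernelMixedDeriv Ω ν (j + 1) k z w)) := by
    intro j k h z hz w hw
    obtain ⟨r, hr, hb⟩ := Metric.nhds_basis_closedBall.mem_iff.1 (H.isOpen_lim.mem_nhds hz)
    obtain ⟨C, hC⟩ := H.bound _ hb (isCompact_closedBall z r)
    have hb' := Metric.ball_subset_closedBall.trans hb
    have hder := fun x (hx : x ∈ Ω) => H.admissible_lim.hasDerivAt_kernelMixedDeriv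
      H.isOpen_lim H.isPreconnected_lim j k hx hw
    have hderi := fun i (hi : w ∈ D i) x (hx : x ∈ D i) =>
      (H.admissible i).hasDerivAt_kernelMixedDeriv (H.isOpen i) (H.isPreconnected i) j k hx hi
    have hloc : TendstoLocallyUniformlyOn (fun i x => kernelMixedDeriv (D i) (μ i) j k x w)
        (fun x => kernelMixedDeriv Ω ν j k x w) atTop (Metric.ball z r) :=
      tendstoLocallyUniformlyOn_of_forall_tendsto_prod
        (fun x hx => (hder x (hb' hx)).continuousAt.continuousWithinAt)
        (fun x hx => H.tendsto_kernelMixedDeriv_prod_fst (hb' hx) hw (h x (hb' hx) w hw))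
    have hd := (hloc.deriv (by
      filter_upwards [hC, hmem w hw] with i hi hiw x hx
      exact (hderi i hiw x (hi.1 (Metric.ball_subset_closedBall
        hx))).differentiableAt.differentiableWithinAt) Metric.isOpen_ball).tendsto_at
      (Metric.mem_ball_self hr)
    rw [(hder z hz).deriv] at hd
    refine hd.congr' ?_
    filter_upwards [hmem z hz, hmem w hw] with i hiz hiw
    exact (hderi i hiw z hiz).deriv
  have h0 : ∀ k, ∀ z ∈ Ω, ∀ w ∈ Ω, Tendsto (fun i => kernelMixedDeriv (D i) (μ i) k 0 z w)
      atTop (𝓝 (kernelMixedDeriv Ω ν k 0 z w)) := by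
    intro k
    induction k with
    | zero => simpa only [kernelMixedDeriv_zero_zero] using H.tendsto
    | succ k ih => exact hsucc _ _ ih
  induction j with
  | zero => exact hsymm _ _ (h0 k)
  | succ j ih => exact hsucc _ _ ih

theorem eventually_mem_prod (H : KernelConvergence D μ Ω ν) {p : ℂ × ℂ} (hp : p ∈ Ω ×ˢ Ω) :
    ∀ᶠ x : ℕ × (ℂ × ℂ) in atTop ×ˢ 𝓝 p, x.2.1 ∈ D x.1 ∧ x.2.2 ∈ D x.1 := by
  obtain ⟨r, hr, hb⟩ := Metric.nhds_basis_closedBall.mem_iff.1 (H.isOpen_lim.mem_nhds hp.1)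
  obtain ⟨s, hs, hb'⟩ := Metric.nhds_basis_closedBall.mem_iff.1 (H.isOpen_lim.mem_nhds hp.2)
  obtain ⟨C, hC⟩ := H.bound _ (Set.union_subset hb hb')
    ((isCompact_closedBall p.1 r).union (isCompact_closedBall p.2 s))
  filter_upwards [prod_mem_prod hC (prod_mem_nhds (Metric.closedBall_mem_nhds p.1 hr)
    (Metric.closedBall_mem_nhds p.2 hs))] with x hx
  exact ⟨hx.1.1 (Or.inl hx.2.1), hx.1.1 (Or.inr hx.2.2)⟩

theorem tendsto_kernelMixedDeriv_prod (H : KernelConvergence D μ Ω ν) (j k : ℕ) {p : ℂ × ℂ}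
    (hp : p ∈ Ω ×ˢ Ω) :
    Tendsto (fun x : ℕ × (ℂ × ℂ) => kernelMixedDeriv (D x.1) (μ x.1) j k x.2.1 x.2.2)
      (atTop ×ˢ 𝓝 p) (𝓝 (kernelMixedDeriv Ω ν j k p.1 p.2)) := by
  obtain ⟨r, hr, hb⟩ := Metric.nhds_basis_closedBall.mem_iff.1 (H.isOpen_lim.mem_nhds hp.1)
  obtain ⟨s, hs, hb'⟩ := Metric.nhds_basis_closedBall.mem_iff.1 (H.isOpen_lim.mem_nhds hp.2)
  have hU := Set.union_subset hb hb'
  have hK := (isCompact_closedBall p.1 r).union (isCompact_closedBall p.2 s)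
  obtain ⟨C₁, hC₁⟩ := H.bound_kernelMixedDeriv (j + 1) k _ hU hK
  obtain ⟨C₂, hC₂⟩ := H.bound_kernelMixedDeriv (k + 1) j _ hU hK
  -- One variable moves at a time, through `(p.1, x.2.2)`. The increment in the second variable is
  -- conjugated into one in the first.
  refine tendsto_prod_nhds_of_lipschitz
    (F := fun i (q : ℂ × ℂ) => kernelMixedDeriv (D i) (μ i) j k q.1 q.2) (|C₁| + |C₂|)
    (H.tendsto_kernelMixedDeriv j k _ hp.1 _ hp.2) ?_
  filter_upwards [prod_mem_prod (hC₁.and hC₂) (prod_mem_nhds (Metric.ball_mem_nhds p.1 hr)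
    (Metric.ball_mem_nhds p.2 hs))] with x ⟨⟨hx1, hx2⟩, hx3, hx4⟩
  have hμ := H.admissible x.1
  have hO := H.isOpen x.1
  have hc := H.isPreconnected x.1
  have hr1 : Metric.ball p.1 r ⊆ Metric.closedBall p.1 r ∪ Metric.closedBall p.2 s :=
    Metric.ball_subset_closedBall.trans Set.subset_union_left
  have hs1 : Metric.ball p.2 s ⊆ Metric.closedBall p.1 r ∪ Metric.closedBall p.2 s :=
    Metric.ball_subset_closedBall.trans Set.subset_union_right
  have hp1 := Metric.mem_ball_self (x := p.1) hr
  have hp2 := Metric.mem_ball_self (x := p.2) hs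
  have e1 := hμ.norm_kernelMixedDeriv_sub_le hO hc (hr1.trans hx1.1) (hx1.1 (hs1 hx4))
    (fun z hz => hx1.2 z (hr1 hz) _ (hs1 hx4)) hx3 hp1
  have e2 := hμ.norm_kernelMixedDeriv_sub_le hO hc (hs1.trans hx1.1) (hx1.1 (hr1 hp1))
    (fun z hz => hx2.2 z (hs1 hz) _ (hr1 hp1)) hx4 hp2
  rw [← RCLike.norm_conj, map_sub,
    ← hμ.kernelMixedDeriv_symm hO hc _ _ (hx1.1 (hr1 hp1)) (hx1.1 (hs1 hx4)),
    ← hμ.kernelMixedDeriv_symm hO hc _ _ (hx1.1 (hr1 hp1)) (hx1.1 (hs1 hp2))] at e2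
  have d1 : ‖x.2.1 - p.1‖ ≤ dist x.2 p := by rw [← dist_eq_norm]; exact le_max_left _ _
  have d2 : ‖x.2.2 - p.2‖ ≤ dist x.2 p := by rw [← dist_eq_norm]; exact le_max_right _ _
  refine (dist_triangle _ (kernelMixedDeriv (D x.1) (μ x.1) j k p.1 x.2.2) _).trans ?_
  rw [dist_eq_norm, dist_eq_norm, add_mul]
  refine add_le_add (e1.trans ?_) (e2.trans ?_)
  · exact mul_le_mul (le_abs_self _) d1 (norm_nonneg _) (abs_nonneg _)
  · exact mul_le_mul (le_abs_self _) d2 (norm_nonneg _) (abs_nonneg _)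

end KernelConvergence

/-! ### Real differentials of the mixed derivatives -/

section Smooth

variable {D : Set ℂ} {μ : ℂ → ℝ}

theorem IsAdmissibleWeight.continuousAt_kernelMixedDeriv (hμ : IsAdmissibleWeight D μ)
    (hD : IsOpen D) (hc : IsPreconnected D) (j k : ℕ) {p : ℂ × ℂ} (hp : p ∈ D ×ˢ D) :
    ContinuousAt (fun p : ℂ × ℂ => kernelMixedDeriv D μ j k p.1 p.2) p := by
  have h := (hμ.kernelConvergence_const hD hc).tendsto_kernelMixedDeriv_prod j k hp
  have h1 : Tendsto ((fun p : ℂ × ℂ => kernelMixedDeriv D μ j k p.1 p.2) ∘ Prod.snd)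
    ((atTop : Filter ℕ) ×ˢ 𝓝 p) (𝓝 (kernelMixedDeriv D μ j k p.1 p.2)) := h
  rwa [← tendsto_map'_iff, map_snd_prod] at h1

/-- The covectors `dz`, `dw̄`, `dw` on `ℂ × ℂ`. -/
noncomputable def kernelCovectors : Fin 3 → ℂ × ℂ →L[ℝ] ℂ :=
  ![ContinuousLinearMap.fst ℝ ℂ ℂ,
    (Complex.conjCLE : ℂ →L[ℝ] ℂ).comp (ContinuousLinearMap.snd ℝ ℂ ℂ),
    ContinuousLinearMap.snd ℝ ℂ ℂ]

theorem covectorSum_kernelCovectors (c : Fin 3 → ℂ) (v : ℂ × ℂ) :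
    covectorSum kernelCovectors c v = c 0 * v.1 + c 1 * conj v.2 + c 2 * v.2 := by
  simp [covectorSum_apply, Fin.sum_univ_three, kernelCovectors]

/-- Holomorphy in `z` and antiholomorphy in `w` give the partial differentials, whose continuity
makes the function differentiable. The coefficients are again mixed derivatives, so the induction on
the order closes up. -/
theorem IsAdmissibleWeight.hasFDerivAt_kernelMixedDeriv (hμ : IsAdmissibleWeight D μ)
    (hD : IsOpen D) (hc : IsPreconnected D) (j k : ℕ) {p : ℂ × ℂ} (hp : p ∈ D ×ˢ D) :
    HasFDerivAt (fun p : ℂ × ℂ => kernelMixedDeriv D μ j k p.1 p.2)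
      (covectorSum kernelCovectors ![kernelMixedDeriv D μ (j + 1) k p.1 p.2,
        kernelMixedDeriv D μ j (k + 1) p.1 p.2, 0]) p := by
  let f₁ : ℂ → ℂ → ℂ →L[ℝ] ℂ := fun z w =>
    ContinuousLinearMap.mul ℝ ℂ (kernelMixedDeriv D μ (j + 1) k z w)
  let f₂ : ℂ → ℂ → ℂ →L[ℝ] ℂ := fun z w =>
    (ContinuousLinearMap.mul ℝ ℂ (kernelMixedDeriv D μ j (k + 1) z w)).comp
      (Complex.conjCLE : ℂ →L[ℝ] ℂ)
  have hnhds : D ×ˢ D ∈ 𝓝 p := (hD.prod hD).mem_nhds hp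
  have hreal : ∀ {g : ℂ → ℂ} {g' x : ℂ}, HasDerivAt g g' x →
      HasFDerivAt g (ContinuousLinearMap.mul ℝ ℂ g') x := fun {g g' x} h => by
    exact (h.hasFDerivAt.restrictScalars ℝ).congr_fderiv
      (ContinuousLinearMap.ext fun v => by simp [mul_comm])
  have df₁ : ∀ᶠ v in 𝓝 p, HasFDerivAt (fun z => kernelMixedDeriv D μ j k z v.2)
      (f₁ v.1 v.2) v.1 := by
    filter_upwards [hnhds] with v hv
    exact hreal (hμ.hasDerivAt_kernelMixedDeriv hD hc j k hv.1 hv.2)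
  have df₂ : ∀ᶠ v in 𝓝 p, HasFDerivAt (fun w => kernelMixedDeriv D μ j k v.1 w)
      (f₂ v.1 v.2) v.2 := by
    filter_upwards [hnhds] with v hv
    have h1 := (Complex.conjCLE : ℂ →L[ℝ] ℂ).hasFDerivAt.comp v.2
      (hreal (hμ.hasDerivAt_kernelMixedDeriv hD hc k j hv.2 hv.1))
    have h2 : (Complex.conjCLE : ℂ →L[ℝ] ℂ).comp (ContinuousLinearMap.mul ℝ ℂ
        (kernelMixedDeriv D μ (k + 1) j v.2 v.1)) = f₂ v.1 v.2 := by
      apply ContinuousLinearMap.ext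
      intro x
      simp [f₂, hμ.kernelMixedDeriv_symm hD hc j (k + 1) hv.1 hv.2]
    rw [h2] at h1
    refine h1.congr_of_eventuallyEq ?_
    filter_upwards [hD.mem_nhds hv.2] with w hw
    simpa using hμ.kernelMixedDeriv_symm hD hc j k hv.1 hw
  have cf₁ : ContinuousAt (fun v : ℂ × ℂ => f₁ v.1 v.2) p :=
    (ContinuousLinearMap.mul ℝ ℂ).continuous.continuousAt.comp
      (hμ.continuousAt_kernelMixedDeriv hD hc (j + 1) k hp)
  have cf₂ : ContinuousAt (fun v : ℂ × ℂ => f₂ v.1 v.2) p :=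
    ((ContinuousLinearMap.mul ℝ ℂ).continuous.continuousAt.comp
      (hμ.continuousAt_kernelMixedDeriv hD hc j (k + 1) hp)).clm_comp continuousAt_const
  have h := (hasStrictFDerivAt_uncurry_coprod (𝕜 := ℝ) (f := fun z w => kernelMixedDeriv D μ j k z w)
    (f₁ := f₁) (f₂ := f₂) df₁ df₂ cf₁ cf₂).hasFDerivAt
  refine h.congr_fderiv (ContinuousLinearMap.ext fun v => ?_)
  simp [covectorSum_kernelCovectors, f₁, f₂, Function.HasUncurry.uncurry]

/-- The chain rule along `p ↦ (p.2, p.2)`; on the diagonal the covector `dw` appears, and Gram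
entries are of this kind. -/
theorem IsAdmissibleWeight.hasFDerivAt_kernelMixedDeriv_diag (hμ : IsAdmissibleWeight D μ)
    (hD : IsOpen D) (hc : IsPreconnected D) (j k : ℕ) {p : ℂ × ℂ} (hp : p.2 ∈ D) :
    HasFDerivAt (fun p : ℂ × ℂ => kernelMixedDeriv D μ j k p.2 p.2)
      (covectorSum kernelCovectors ![0, kernelMixedDeriv D μ j (k + 1) p.2 p.2,
        kernelMixedDeriv D μ (j + 1) k p.2 p.2]) p := by
  have h := (hμ.hasFDerivAt_kernelMixedDeriv hD hc j k (p := (p.2, p.2)) ⟨hp, hp⟩).comp p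
    (((ContinuousLinearMap.snd ℝ ℂ ℂ).prod (ContinuousLinearMap.snd ℝ ℂ ℂ)).hasFDerivAt)
  refine h.congr_fderiv (ContinuousLinearMap.ext fun v => ?_)
  simp [covectorSum_kernelCovectors, add_comm]

end Smooth

/-! ### Smooth convergence of the kernels of higher order -/

namespace KernelConvergence

variable {D : ℕ → Set ℂ} {μ : ℕ → ℂ → ℝ} {Ω : Set ℂ} {ν : ℂ → ℝ}

theorem smoothTendsto_kernelMixedDeriv (H : KernelConvergence D μ Ω ν) (m j k : ℕ) {p : ℂ × ℂ}
    (hp : p ∈ Ω ×ˢ Ω) :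
    SmoothTendsto kernelCovectors p m
      (fun i q => kernelMixedDeriv (D i) (μ i) j k q.1 q.2)
      (fun q => kernelMixedDeriv Ω ν j k q.1 q.2) := by
  induction m generalizing j k with
  | zero => exact H.tendsto_kernelMixedDeriv_prod j k hp
  | succ m ih =>
    refine ⟨H.tendsto_kernelMixedDeriv_prod j k hp,
      fun a i q => ![kernelMixedDeriv (D i) (μ i) (j + 1) k q.1 q.2,
        kernelMixedDeriv (D i) (μ i) j (k + 1) q.1 q.2, 0] a,
      fun a q => ![kernelMixedDeriv Ω ν (j + 1) k q.1 q.2,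
        kernelMixedDeriv Ω ν j (k + 1) q.1 q.2, 0] a, ?_, ?_, fun a => ?_⟩
    · filter_upwards [H.eventually_mem_prod hp] with x hx
      exact (H.admissible x.1).hasFDerivAt_kernelMixedDeriv (H.isOpen _) (H.isPreconnected _) j k hx
    · filter_upwards [(H.isOpen_lim.prod H.isOpen_lim).mem_nhds hp] with q hq
      exact H.admissible_lim.hasFDerivAt_kernelMixedDeriv H.isOpen_lim H.isPreconnected_lim j k hq
    · fin_cases a
      · exact ih (j + 1) k
      · exact ih j (k + 1)
      · exact SmoothTendsto.const m 0

theorem smoothTendsto_kernelMixedDeriv_diag (H : KernelConvergence D μ Ω ν) (m j k : ℕ)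
    {p : ℂ × ℂ} (hp : p.2 ∈ Ω) :
    SmoothTendsto kernelCovectors p m
      (fun i q => kernelMixedDeriv (D i) (μ i) j k q.2 q.2)
      (fun q => kernelMixedDeriv Ω ν j k q.2 q.2) := by
  have hp' : (p.2, p.2) ∈ Ω ×ˢ Ω := ⟨hp, hp⟩
  have hdiag : Tendsto (fun x : ℕ × (ℂ × ℂ) => (x.1, (x.2.2, x.2.2))) (atTop ×ˢ 𝓝 p)
      (atTop ×ˢ 𝓝 (p.2, p.2)) :=
    tendsto_fst.prodMk (((continuous_snd.prodMk continuous_snd).tendsto p).comp tendsto_snd)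
  induction m generalizing j k with
  | zero => exact (H.tendsto_kernelMixedDeriv_prod j k hp').comp hdiag
  | succ m ih =>
    refine ⟨(H.tendsto_kernelMixedDeriv_prod j k hp').comp hdiag,
      fun a i q => ![0, kernelMixedDeriv (D i) (μ i) j (k + 1) q.2 q.2,
        kernelMixedDeriv (D i) (μ i) (j + 1) k q.2 q.2] a,
      fun a q => ![0, kernelMixedDeriv Ω ν j (k + 1) q.2 q.2,
        kernelMixedDeriv Ω ν (j + 1) k q.2 q.2] a, ?_, ?_, fun a => ?_⟩
    · filter_upwards [hdiag.eventually (H.eventually_mem_prod hp')] with x hx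
      exact (H.admissible x.1).hasFDerivAt_kernelMixedDeriv_diag (H.isOpen _)
        (H.isPreconnected _) j k hx.1
    · filter_upwards [continuous_snd.continuousAt.preimage_mem_nhds (H.isOpen_lim.mem_nhds hp)]
        with q hq
      exact H.admissible_lim.hasFDerivAt_kernelMixedDeriv_diag H.isOpen_lim
        H.isPreconnected_lim j k hq
    · fin_cases a
      · exact SmoothTendsto.const m 0
      · exact ih j (k + 1)
      · exact ih (j + 1) k

theorem smoothTendsto_kernelGramDet (H : KernelConvergence D μ Ω ν) (m n : ℕ) {p : ℂ × ℂ}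
    (hp : p.2 ∈ Ω) :
    SmoothTendsto kernelCovectors p m (fun i q => kernelGramDet (D i) (μ i) n q.2)
      (fun q => kernelGramDet Ω ν n q.2) := by
  simp only [kernelGramDet]
  exact SmoothTendsto.det fun j k => H.smoothTendsto_kernelMixedDeriv_diag m j k hp

/-- The points near a regular point are eventually regular for the approximating kernels. -/
theorem eventually_regular (H : KernelConvergence D μ Ω ν) (n : ℕ) {p : ℂ × ℂ}
    (hp : p ∈ Ω ×ˢ Ω) (hJ : kernelGramDet Ω ν n p.2 ≠ 0) :
    ∀ᶠ x : ℕ × (ℂ × ℂ) in atTop ×ˢ 𝓝 p, x.2 ∈ D x.1 ×ˢ D x.1 ∧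
      kernelGramDet (D x.1) (μ x.1) n x.2.2 ≠ 0 :=
  (H.eventually_mem_prod hp).and
    ((H.smoothTendsto_kernelGramDet 0 n hp.2).tendsto.eventually_ne hJ)

/-- The Gram determinants converge to a nonzero value, so Cramer's formula is valid near `p` for all
large indices, and each of its ingredients converges smoothly. -/
theorem smoothTendsto_reducedKernel (H : KernelConvergence D μ Ω ν) (m n : ℕ) {p : ℂ × ℂ}
    (hp : p ∈ Ω ×ˢ Ω) (hJ : kernelGramDet Ω ν n p.2 ≠ 0) :
    SmoothTendsto kernelCovectors p m
      (fun i q => reducedKernel (D i) (μ i) (n + 2) q.1 q.2)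
      (fun q => reducedKernel Ω ν (n + 2) q.1 q.2) := by
  have hA := fun j k => H.smoothTendsto_kernelMixedDeriv m j k hp
  have hB := fun j k => H.smoothTendsto_kernelMixedDeriv_diag m j k hp.2
  have hadj : ∀ k l : Fin (n + 1), SmoothTendsto kernelCovectors p m
      (fun i q => (Matrix.of fun j k : Fin (n + 1) =>
        kernelMixedDeriv (D i) (μ i) j k q.2 q.2).adjugate k l)
      (fun q => (Matrix.of fun j k : Fin (n + 1) =>
        kernelMixedDeriv Ω ν j k q.2 q.2).adjugate k l) := fun k l =>
    SmoothTendsto.adjugate (κ := Fin (n + 1)) (fun j k => hB j k) k l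
  have hinv := (H.smoothTendsto_kernelGramDet m n hp.2).inv hJ
  have hsum := (hA 0 (n + 1)).add ((SmoothTendsto.const m (-1)).mul (SmoothTendsto.sum Finset.univ
    fun k : Fin (n + 1) => ((SmoothTendsto.sum Finset.univ fun l : Fin (n + 1) =>
      (hadj k l).mul (hB l (n + 1))).mul hinv).mul (hA 0 k)))
  refine hsum.congr ?_ ?_
  · filter_upwards [H.eventually_regular n hp hJ] with x hx
    rw [(H.admissible x.1).reducedKernel_eq (H.isOpen _) (H.isPreconnected _) n hx.1.1 hx.1.2 hx.2,
      neg_one_mul, sub_eq_add_neg]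
  · have hHc := H.admissible_lim.kernelConvergence_const H.isOpen_lim H.isPreconnected_lim
    have h1 := hHc.eventually_regular n hp hJ
    have h2 : ∀ᶠ q in 𝓝 p, q ∈ Ω ×ˢ Ω ∧ kernelGramDet Ω ν n q.2 ≠ 0 := by
      have h3 : ∀ᶠ q in map Prod.snd ((atTop : Filter ℕ) ×ˢ 𝓝 p),
        q ∈ Ω ×ˢ Ω ∧ kernelGramDet Ω ν n q.2 ≠ 0 := h1
      rwa [map_snd_prod] at h3
    filter_upwards [h2] with q hq
    rw [H.admissible_lim.reducedKernel_eq H.isOpen_lim H.isPreconnected_lim n hq.1.1 hq.1.2 hq.2,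
      neg_one_mul, sub_eq_add_neg]

theorem tendstoLocallyUniformlyOn_reducedKernel (H : KernelConvergence D μ Ω ν) :
    TendstoLocallyUniformlyOn (fun i (p : ℂ × ℂ) => reducedKernel (D i) (μ i) 1 p.1 p.2)
      (fun p => reducedKernel Ω ν 1 p.1 p.2) atTop (Ω ×ˢ Ω) := by
  simp only [← kernelMixedDeriv_zero_zero]
  exact tendstoLocallyUniformlyOn_of_forall_tendsto_prod
    (fun p hp => (H.admissible_lim.continuousAt_kernelMixedDeriv H.isOpen_lim
      H.isPreconnected_lim 0 0 hp).continuousWithinAt)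
    (fun p hp => H.tendsto_kernelMixedDeriv_prod 0 0 hp)

end KernelConvergence

theorem IsAdmissibleWeight.contDiffAt_reducedKernel {D : Set ℂ} {μ : ℂ → ℝ}
    (hμ : IsAdmissibleWeight D μ) (hD : IsOpen D) (hc : IsPreconnected D) (n : ℕ) {p : ℂ × ℂ}
    (hp : p ∈ D ×ˢ D) (hJ : kernelGramDet D μ n p.2 ≠ 0) :
    ContDiffAt ℝ ∞ (fun q : ℂ × ℂ => reducedKernel D μ (n + 2) q.1 q.2) p :=
  contDiffAt_infty.2 fun m => ((hμ.kernelConvergence_const hD hc).smoothTendsto_reducedKernel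
    (m + 1) n hp hJ).contDiffAt

theorem KernelConvergence.allDerivsTendstoLocallyUniformlyOn {D : ℕ → Set ℂ} {μ : ℕ → ℂ → ℝ}
    {Ω : Set ℂ} {ν : ℂ → ℝ} (H : KernelConvergence D μ Ω ν) {n : ℕ} (hn : 1 < n) :
    AllDerivsTendstoLocallyUniformlyOn
      (fun i p => reducedKernel (D i) (μ i) n p.1 p.2)
      (fun p => reducedKernel Ω ν n p.1 p.2) (Ω ×ˢ regularPoints Ω ν n) := by
  obtain ⟨n, rfl⟩ : ∃ k, n = k + 2 := ⟨n - 2, by omega⟩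
  have hU : ∀ p ∈ Ω ×ˢ regularPoints Ω ν (n + 2), p ∈ Ω ×ˢ Ω ∧ kernelGramDet Ω ν n p.2 ≠ 0 :=
    fun p hp => ⟨⟨hp.1, hp.2.1.1⟩, hp.2.2⟩
  have hsmooth := fun p hp => H.admissible_lim.contDiffAt_reducedKernel H.isOpen_lim
    H.isPreconnected_lim n (hU p hp).1 (hU p hp).2
  refine ⟨hsmooth, fun L hL hLc => ?_, fun m => ?_⟩
  · have h1 : {x : ℕ × (ℂ × ℂ) | x.2 ∈ D x.1 ×ˢ D x.1 ∧
        kernelGramDet (D x.1) (μ x.1) n x.2.2 ≠ 0} ∈ atTop ×ˢ 𝓝ˢ L :=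
      hLc.mem_prod_nhdsSet_of_forall fun p hp =>
        H.eventually_regular n (hU p (hL hp)).1 (hU p (hL hp)).2
    obtain ⟨pa, ha, pb, hb, hab⟩ := eventually_prod_iff.1 h1
    filter_upwards [ha] with i hi p hp
    have h2 := hab hi (subset_of_mem_nhdsSet hb hp)
    exact (H.admissible i).contDiffAt_reducedKernel (H.isOpen i) (H.isPreconnected i) n h2.1 h2.2
  · refine tendstoLocallyUniformlyOn_of_forall_tendsto_prod (fun p hp => ?_) fun p hp =>
      (H.smoothTendsto_reducedKernel (m + 1) n (hU p hp).1 (hU p hp).2).tendsto_iteratedFDeriv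
    have h1 := (hsmooth p hp).iteratedFDeriv_right (i := m) (m := 0)
      (by exact_mod_cast le_top)
    exact h1.continuousAt.continuousWithinAt

/-! ### Comparison of nested weighted domains -/

section Comparison

variable {D D' : Set ℂ} {μ μ' : ℂ → ℝ} {h : ℂ → ℂ}

theorem weightedArea_mono (hD' : IsOpen D') (hsub : D' ⊆ D) (hle : ∀ z ∈ D', μ' z ≤ μ z) :
    weightedArea D' μ' ≤ weightedArea D μ :=
  (withDensity_mono ((ae_restrict_iff' hD'.measurableSet).2 (Eventually.of_forall fun z hz =>
    ENNReal.ofReal_le_ofReal (hle z hz)))).trans <| Measure.le_iff.2 fun s hs => by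
      rw [withDensity_apply _ hs, weightedArea, withDensity_apply _ hs]
      exact lintegral_mono' (Measure.restrict_mono le_rfl (Measure.restrict_mono hsub le_rfl)) le_rfl

theorem MemReduced.mono (hD' : IsOpen D') (hsub : D' ⊆ D) (hle : ∀ z ∈ D', μ' z ≤ μ z)
    (hh : MemReduced D μ h) : MemReduced D' μ' h := by
  obtain ⟨⟨f, hf⟩, h2⟩ := hh
  exact ⟨⟨f, fun z hz => hf z (hsub hz)⟩, h2.mono_measure (weightedArea_mono hD' hsub hle)⟩

theorem weightedNormSq_mono (hD' : IsOpen D') (hsub : D' ⊆ D) (hle : ∀ z ∈ D', μ' z ≤ μ z)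
    (hh : MemReduced D μ h) : weightedNormSq D' μ' h ≤ weightedNormSq D μ h := by
  refine integral_mono_measure (weightedArea_mono hD' hsub hle)
    (Eventually.of_forall fun z => sq_nonneg _) ?_
  have := hh.2.integrable_norm_pow two_ne_zero
  simpa using this

/-- The distance of the kernels of two nested weighted domains. -/
theorem weightedNormSq_sub_reducedRep_le (hD' : IsOpen D') (hsub : D' ⊆ D)
    (hle : ∀ z ∈ D', μ' z ≤ μ z) {m : ℕ} {w : ℂ} {κ κ' : ℂ → ℂ} (hκ : IsReducedRep D μ m w κ)
    (hκ' : IsReducedRep D' μ' m w κ') :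
    weightedNormSq D' μ' (κ' - κ) ≤ weightedNormSq D' μ' κ' - weightedNormSq D μ κ := by
  have hr := hκ.1.mono hD' hsub hle
  have h1 : weightedInner D' μ' κ' κ = (weightedNormSq D μ κ : ℂ) := by
    rw [← conj_weightedInner, ← hκ'.2.2 κ hr hκ.2.1, hκ.iteratedDeriv_self, Complex.conj_ofReal]
  rw [weightedNormSq_sub hκ'.1.2 hr.2, h1, Complex.ofReal_re]
  linarith [weightedNormSq_mono hD' hsub hle hκ.1]

end Comparison

/-! ### Decreasing sequences of domains -/

/-- Decreasing weighted domains with convergence of the kernels on the diagonal. -/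
theorem KernelConvergence.of_decreasing {D : ℕ → Set ℂ} {μ : ℕ → ℂ → ℝ}
    (hD : ∀ i, IsOpen (D i) ∧ IsConnected (D i)) (hμ : ∀ i, IsAdmissibleWeight (D i) (μ i))
    {Ω : Set ℂ} {ν : ℂ → ℝ} (hΩ : IsOpen Ω) (hΩc : IsPreconnected Ω)
    (hν : IsAdmissibleWeight Ω ν) (hsub : ∀ i, Ω ⊆ D i) (hle : ∀ i, ∀ z ∈ Ω, ν z ≤ μ i z)
    (hlim : ∀ t ∈ Ω, Tendsto (fun i => reducedKernel (D i) (μ i) 1 t t) atTop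
      (𝓝 (reducedKernel Ω ν 1 t t))) : KernelConvergence D μ Ω ν where
  isOpen i := (hD i).1
  isPreconnected i := (hD i).2.isPreconnected
  admissible := hμ
  isOpen_lim := hΩ
  isPreconnected_lim := hΩc
  admissible_lim := hν
  -- Restriction to `Ω` does not increase norms, so the evaluation constant of `Ω` serves every `D
  -- i`.
  bound L hLΩ hL := by
    obtain ⟨C, hC0, hC⟩ := hν.exists_sq_bound_on_compact hΩ hL hLΩ
    refine ⟨C, Eventually.of_forall fun i => ⟨hLΩ.trans (hsub i), fun z hz w hw => ?_⟩⟩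
    refine norm_reducedKernel_le (hμ i) (hD i).1 (hD i).2.isPreconnected (hLΩ.trans (hsub i)) hC0
      (fun h hh x hx => ?_) hz hw
    exact (hC h (hh.mono hΩ (hsub i) (hle i)) x hx).trans
      (mul_le_mul_of_nonneg_left (weightedNormSq_mono hΩ (hsub i) (hle i) hh) hC0)
  -- The comparison bounds the squared distance of the two kernels on `Ω` by `K(w, w) - K_i(w, w)`,
  -- which tends to zero by hypothesis.
  tendsto z hz w hw := by
    obtain ⟨C, hC0, hC⟩ := hν.exists_sq_bound_on_compact hΩ isCompact_singleton
      (Set.singleton_subset_iff.2 hz)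
    have hκ := hν.isReducedRep hΩ hΩc hw 0
    have hκi := fun i => (hμ i).isReducedRep (hD i).1 (hD i).2.isPreconnected (hsub i hw) 0
    have hK : (weightedNormSq Ω ν fun z => reducedKernel Ω ν 1 z w) =
        (reducedKernel Ω ν 1 w w).re := by
      have := hκ.iteratedDeriv_self
      simp only [iteratedDeriv_zero, zero_add] at this
      rw [this, Complex.ofReal_re]
    have hKi : ∀ i, (weightedNormSq (D i) (μ i) fun z => reducedKernel (D i) (μ i) 1 z w) =
        (reducedKernel (D i) (μ i) 1 w w).re := fun i => by
      have := (hκi i).iteratedDeriv_self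
      simp only [iteratedDeriv_zero, zero_add] at this
      rw [this, Complex.ofReal_re]
    have h0 : Tendsto (fun i => C * ((reducedKernel Ω ν 1 w w).re -
        (reducedKernel (D i) (μ i) 1 w w).re)) atTop (𝓝 0) := by
      have := ((Complex.continuous_re.tendsto _).comp (hlim w hw)).const_sub
        (reducedKernel Ω ν 1 w w).re
      simpa using this.const_mul C
    have h1 : Tendsto (fun i => ‖reducedKernel Ω ν 1 z w - reducedKernel (D i) (μ i) 1 z w‖ ^ 2)
        atTop (𝓝 0) := by
      refine squeeze_zero (fun i => sq_nonneg _) (fun i => ?_) h0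
      have h2 := hC _ (hκ.1.sub ((hκi i).1.mono hΩ (hsub i) (hle i))) z rfl
      have h3 := weightedNormSq_sub_reducedRep_le hΩ (hsub i) (hle i) (hκi i) hκ
      simp only [zero_add] at h2 h3
      rw [hK, hKi] at h3
      exact h2.trans (mul_le_mul_of_nonneg_left h3 hC0)
    have h4 : Tendsto (fun i => ‖reducedKernel (D i) (μ i) 1 z w - reducedKernel Ω ν 1 z w‖)
        atTop (𝓝 0) := by
      have := (Real.continuous_sqrt.tendsto 0).comp h1
      simp only [Real.sqrt_zero] at this
      refine this.congr fun i => ?_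
      simp [Real.sqrt_sq, norm_sub_rev]
    exact tendsto_iff_norm_sub_tendsto_zero.2 h4

/-! ### Increasing exhaustions -/

/-- Eventually increasing weighted domains exhausting `Ω`. -/
structure IsWeightedExhaustion (D : ℕ → Set ℂ) (μ : ℕ → ℂ → ℝ) (Ω : Set ℂ) (ν : ℂ → ℝ) :
    Prop where
  domain : ∀ i, IsOpen (D i) ∧ IsConnected (D i)
  admissible : ∀ i, IsAdmissibleWeight (D i) (μ i)
  union : Ω = ⋃ i, D i
  admissible_lim : IsAdmissibleWeight Ω ν
  eventually_mono : ∀ i, ∃ j, ∀ k ≥ j, D i ⊆ D k ∧ ∀ z ∈ D i, μ i z ≤ μ k z ∧ μ k z ≤ ν z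
  ae_tendsto : ∀ᵐ z ∂(volume.restrict Ω), Tendsto (fun i => μ i z) atTop (𝓝 (ν z))

namespace IsWeightedExhaustion

variable {D : ℕ → Set ℂ} {μ : ℕ → ℂ → ℝ} {Ω : Set ℂ} {ν : ℂ → ℝ}

theorem subset_lim (H : IsWeightedExhaustion D μ Ω ν) (i : ℕ) : D i ⊆ Ω :=
  H.union ▸ Set.subset_iUnion D i

theorem le_lim (H : IsWeightedExhaustion D μ Ω ν) (i : ℕ) : ∀ z ∈ D i, μ i z ≤ ν z := by
  obtain ⟨j, hj⟩ := H.eventually_mono i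
  exact fun z hz => ((hj j le_rfl).2 z hz).1.trans ((hj j le_rfl).2 z hz).2

theorem isOpen_lim (H : IsWeightedExhaustion D μ Ω ν) : IsOpen Ω :=
  H.union ▸ isOpen_iUnion fun i => (H.domain i).1

theorem directed (H : IsWeightedExhaustion D μ Ω ν) : Directed (· ⊆ ·) D := fun i k => by
  obtain ⟨a, ha⟩ := H.eventually_mono i
  obtain ⟨b, hb⟩ := H.eventually_mono k
  exact ⟨max a b, (ha _ (le_max_left _ _)).1, (hb _ (le_max_right _ _)).1⟩

theorem isPreconnected_lim (H : IsWeightedExhaustion D μ Ω ν) : IsPreconnected Ω := by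
  refine isPreconnected_of_forall_pair fun x hx y hy => ?_
  rw [H.union, Set.mem_iUnion] at hx hy
  obtain ⟨i, hi⟩ := hx
  obtain ⟨k, hk⟩ := hy
  obtain ⟨l, hl1, hl2⟩ := H.directed i k
  exact ⟨D l, H.subset_lim l, hl1 hi, hl2 hk, (H.domain l).2.isPreconnected⟩

/-- On compact sets, the evaluations are uniformly bounded along the exhaustion. -/
theorem exists_uniform_bound (H : IsWeightedExhaustion D μ Ω ν) {L : Set ℂ} (hL : IsCompact L)
    (hLΩ : L ⊆ Ω) : ∃ C : ℝ, 0 ≤ C ∧ ∀ᶠ i in atTop, L ⊆ D i ∧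
      ∀ h, MemReduced (D i) (μ i) h → ∀ z ∈ L, ‖h z‖ ^ 2 ≤ C * weightedNormSq (D i) (μ i) h := by
  -- A single `D i` contains `L`; its constant works for all later domains, whose norms dominate.
  obtain ⟨i, hi⟩ := hL.elim_directed_cover D (fun i => (H.domain i).1) (H.union ▸ hLΩ) H.directed
  obtain ⟨C, hC0, hC⟩ := (H.admissible i).exists_sq_bound_on_compact (H.domain i).1 hL hi
  obtain ⟨j, hj⟩ := H.eventually_mono i
  refine ⟨C, hC0, eventually_atTop.2 ⟨j, fun k hk => ⟨hi.trans (hj k hk).1, fun h hh z hz => ?_⟩⟩⟩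
  have hle : ∀ z ∈ D i, μ i z ≤ μ k z := fun z hz => ((hj k hk).2 z hz).1
  exact (hC h (hh.mono (H.domain i).1 (hj k hk).1 hle) z hz).trans (mul_le_mul_of_nonneg_left
    (weightedNormSq_mono (H.domain i).1 (hj k hk).1 hle hh) hC0)

theorem eventually_mem (H : IsWeightedExhaustion D μ Ω ν) {w : ℂ} (hw : w ∈ Ω) :
    ∀ᶠ i in atTop, w ∈ D i := by
  obtain ⟨C, -, hC⟩ := H.exists_uniform_bound isCompact_singleton (Set.singleton_subset_iff.2 hw)
  exact hC.mono fun i hi => hi.1 rfl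

theorem isReducedRep (H : IsWeightedExhaustion D μ Ω ν) (m : ℕ) {w : ℂ} {i : ℕ} (hw : w ∈ D i) :
    IsReducedRep (D i) (μ i) m w (fun z => reducedKernel (D i) (μ i) (m + 1) z w) :=
  (H.admissible i).isReducedRep (H.domain i).1 (H.domain i).2.isPreconnected hw m

theorem isReducedRep_lim (H : IsWeightedExhaustion D μ Ω ν) (m : ℕ) {w : ℂ} (hw : w ∈ Ω) :
    IsReducedRep Ω ν m w (fun z => reducedKernel Ω ν (m + 1) z w) :=
  H.admissible_lim.isReducedRep H.isOpen_lim H.isPreconnected_lim hw m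

theorem lintegral_weightedArea {D : Set ℂ} {μ : ℂ → ℝ} (hD : IsOpen D)
    (hμ : AEMeasurable μ (volume.restrict D)) {h : ℂ → ℂ} (hh : ContinuousOn h D) :
    AEMeasurable (D.indicator fun z => ENNReal.ofReal (μ z) * ‖h z‖ₑ ^ 2) volume ∧
    ∫⁻ z, ‖h z‖ₑ ^ 2 ∂(weightedArea D μ) =
      ∫⁻ z, D.indicator (fun z => ENNReal.ofReal (μ z) * ‖h z‖ₑ ^ 2) z := by
  have h1 : AEMeasurable (fun z => ‖h z‖ₑ ^ 2) (volume.restrict D) :=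
    ((hh.aestronglyMeasurable hD.measurableSet).enorm).pow_const 2
  refine ⟨(aemeasurable_indicator_iff hD.measurableSet).2 (hμ.ennreal_ofReal.mul h1), ?_⟩
  rw [lintegral_indicator hD.measurableSet, weightedArea,
    lintegral_withDensity_eq_lintegral_mul₀ hμ.ennreal_ofReal h1]
  rfl

theorem lintegral_enorm_sq {D : Set ℂ} {μ : ℂ → ℝ} {h : ℂ → ℂ}
    (hh : MemLp h 2 (weightedArea D μ)) :
    ∫⁻ z, ‖h z‖ₑ ^ 2 ∂(weightedArea D μ) = ENNReal.ofReal (weightedNormSq D μ h) := by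
  rw [weightedNormSq, ofReal_integral_eq_lintegral_ofReal
    (by simpa using hh.integrable_norm_pow two_ne_zero)
    (Eventually.of_forall fun z => sq_nonneg _)]
  refine lintegral_congr fun z => ?_
  rw [ENNReal.ofReal_pow (norm_nonneg _), ofReal_norm]

/-- Fatou's lemma along a weighted exhaustion. -/
theorem weightedNormSq_le_of_tendsto (H : IsWeightedExhaustion D μ Ω ν) {F : ℕ → ℂ → ℂ}
    {h : ℂ → ℂ} {α : ℝ} (hF : ∀ᶠ i in atTop, MemReduced (D i) (μ i) (F i))
    (hlim : ∀ z ∈ Ω, Tendsto (fun i => F i z) atTop (𝓝 (h z))) (hh : ContinuousOn h Ω)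
    (hα : Tendsto (fun i => weightedNormSq (D i) (μ i) (F i)) atTop (𝓝 α)) :
    MemLp h 2 (weightedArea Ω ν) ∧ weightedNormSq Ω ν h ≤ α := by
  obtain ⟨N, hN⟩ := eventually_atTop.1 hF
  have hc := fun i => (hN (i + N) (by omega)).differentiableOn (H.domain _).1 |>.continuousOn
  let G : ℕ → ℂ → ENNReal := fun i => (D (i + N)).indicator
    fun z => ENNReal.ofReal (μ (i + N) z) * ‖F (i + N) z‖ₑ ^ 2
  have hG := fun i => lintegral_weightedArea (H.domain (i + N)).1
    (H.admissible (i + N)).measurable (hc i)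
  have hΩ := lintegral_weightedArea H.isOpen_lim H.admissible_lim.measurable hh
  -- Extension by zero puts all integrals on the plane. A point of `Ω` lies in all late domains, so
  -- the integrands converge almost everywhere.
  have hae : ∀ᵐ z, Ω.indicator (fun z => ENNReal.ofReal (ν z) * ‖h z‖ₑ ^ 2) z =
      liminf (fun i => G i z) atTop := by
    filter_upwards [(ae_restrict_iff' H.isOpen_lim.measurableSet).1 H.ae_tendsto] with z hz
    by_cases hzΩ : z ∈ Ω
    · rw [Set.indicator_of_mem hzΩ]
      refine (Tendsto.liminf_eq ?_).symm
      have h1 : Tendsto (fun i => ENNReal.ofReal (μ i z) * ‖F i z‖ₑ ^ 2) atTop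
          (𝓝 (ENNReal.ofReal (ν z) * ‖h z‖ₑ ^ 2)) := by
        refine ENNReal.Tendsto.mul (ENNReal.tendsto_ofReal (hz hzΩ)) (Or.inr (by simp))
          ((ENNReal.continuous_pow 2).tendsto _ |>.comp (hlim z hzΩ).enorm)
          (Or.inr ENNReal.ofReal_ne_top)
      refine (h1.comp (tendsto_add_atTop_nat N)).congr' ?_
      filter_upwards [(tendsto_add_atTop_nat N).eventually (H.eventually_mem hzΩ)] with i hi
      have hi' : z ∈ D (i + N) := hi
      simp [G, hi']
    · rw [Set.indicator_of_notMem hzΩ]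
      have : (fun i => G i z) = fun _ => (0 : ENNReal) := by
        ext i
        have hi : z ∉ D (i + N) := fun hi => hzΩ (H.subset_lim _ hi)
        simp [G, hi]
      rw [this, liminf_const]
  have hα0 : 0 ≤ α := ge_of_tendsto' hα fun i => weightedNormSq_nonneg _
  have hle : ∫⁻ z, ‖h z‖ₑ ^ 2 ∂(weightedArea Ω ν) ≤ ENNReal.ofReal α := by
    rw [hΩ.2, lintegral_congr_ae hae]
    refine (lintegral_liminf_le' fun i => (hG i).1).trans (le_of_eq ?_)
    refine Tendsto.liminf_eq ?_
    refine ((ENNReal.tendsto_ofReal hα).comp (tendsto_add_atTop_nat N)).congr fun i => ?_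
    rw [← (hG i).2, lintegral_enorm_sq (hN (i + N) (by omega)).2]
    rfl
  have hmem : MemLp h 2 (weightedArea Ω ν) := by
    refine ⟨(hh.aestronglyMeasurable H.isOpen_lim.measurableSet).mono_ac
      (withDensity_absolutelyContinuous _ _), ?_⟩
    rw [eLpNorm_lt_top_iff_lintegral_rpow_enorm_lt_top two_ne_zero ENNReal.ofNat_ne_top]
    simpa using hle.trans_lt ENNReal.ofReal_lt_top
  refine ⟨hmem, ?_⟩
  rw [lintegral_enorm_sq hmem] at hle
  exact (ENNReal.ofReal_le_ofReal_iff hα0).1 hle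

end IsWeightedExhaustion

namespace IsWeightedExhaustion

variable {D : ℕ → Set ℂ} {μ : ℕ → ℂ → ℝ} {Ω : Set ℂ} {ν : ℂ → ℝ}

/-- Along the exhaustion, the distance of two kernels is controlled by the decrease of their norms. -/
theorem weightedNormSq_sub_le (H : IsWeightedExhaustion D μ Ω ν) (m : ℕ) {w : ℂ} {k : ℕ}
    (hk : w ∈ D k) : ∀ᶠ l in atTop, MemReduced (D k) (μ k)
        (fun z => reducedKernel (D l) (μ l) (m + 1) z w) ∧
      weightedNormSq (D k) (μ k) ((fun z => reducedKernel (D k) (μ k) (m + 1) z w) -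
        fun z => reducedKernel (D l) (μ l) (m + 1) z w) ≤
      weightedNormSq (D k) (μ k) (fun z => reducedKernel (D k) (μ k) (m + 1) z w) -
      weightedNormSq (D l) (μ l) (fun z => reducedKernel (D l) (μ l) (m + 1) z w) := by
  obtain ⟨j, hj⟩ := H.eventually_mono k
  filter_upwards [eventually_ge_atTop j] with l hl
  have hle : ∀ z ∈ D k, μ k z ≤ μ l z := fun z hz => ((hj l hl).2 z hz).1
  have hrep := H.isReducedRep m ((hj l hl).1 hk)
  exact ⟨hrep.1.mono (H.domain k).1 (hj l hl).1 hle, weightedNormSq_sub_reducedRep_le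
    (H.domain k).1 (hj l hl).1 hle hrep (H.isReducedRep m hk)⟩

theorem weightedNormSq_sub_lim_le (H : IsWeightedExhaustion D μ Ω ν) (m : ℕ) {w : ℂ} {k : ℕ}
    (hk : w ∈ D k) : MemReduced (D k) (μ k) (fun z => reducedKernel Ω ν (m + 1) z w) ∧
      weightedNormSq (D k) (μ k) ((fun z => reducedKernel (D k) (μ k) (m + 1) z w) -
        fun z => reducedKernel Ω ν (m + 1) z w) ≤
      weightedNormSq (D k) (μ k) (fun z => reducedKernel (D k) (μ k) (m + 1) z w) -
      weightedNormSq Ω ν (fun z => reducedKernel Ω ν (m + 1) z w) := by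
  have hrep := H.isReducedRep_lim m (H.subset_lim k hk)
  exact ⟨hrep.1.mono (H.domain k).1 (H.subset_lim k) (H.le_lim k), weightedNormSq_sub_reducedRep_le
    (H.domain k).1 (H.subset_lim k) (H.le_lim k) hrep (H.isReducedRep m hk)⟩

/-- Each squared norm dominates only the sufficiently late ones, so the sequence need not be
monotone; the infimum over indices with `w ∈ D k` is still the limit. -/
theorem exists_tendsto_weightedNormSq (H : IsWeightedExhaustion D μ Ω ν) (m : ℕ) {w : ℂ}
    (hw : w ∈ Ω) : ∃ α, Tendsto (fun k => weightedNormSq (D k) (μ k)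
      (fun z => reducedKernel (D k) (μ k) (m + 1) z w)) atTop (𝓝 α) ∧
      ∀ᶠ k in atTop, α ≤ weightedNormSq (D k) (μ k)
        (fun z => reducedKernel (D k) (μ k) (m + 1) z w) := by
  set a : ℕ → ℝ := fun k => weightedNormSq (D k) (μ k)
    (fun z => reducedKernel (D k) (μ k) (m + 1) z w) with ha
  have hmem := H.eventually_mem hw
  have hanti : ∀ k, w ∈ D k → ∀ᶠ l in atTop, a l ≤ a k := fun k hk =>
    (H.weightedNormSq_sub_le m hk).mono fun l hl =>
      sub_nonneg.1 ((weightedNormSq_nonneg _).trans hl.2)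
  let S : Set ℝ := a '' {k | w ∈ D k}
  have hbdd : BddBelow S := ⟨0, by rintro _ ⟨k, -, rfl⟩; exact weightedNormSq_nonneg _⟩
  have hne : S.Nonempty := by
    obtain ⟨k, hk⟩ := hmem.exists
    exact ⟨_, k, hk, rfl⟩
  have hge : ∀ᶠ k in atTop, sInf S ≤ a k := hmem.mono fun k hk => csInf_le hbdd ⟨k, hk, rfl⟩
  refine ⟨sInf S, ?_, hge⟩
  refine tendsto_order.2 ⟨fun b hb => hge.mono fun k hk => hb.trans_le hk, fun b hb => ?_⟩
  obtain ⟨_, ⟨k, hk, rfl⟩, hkb⟩ := exists_lt_of_csInf_lt hne hb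
  exact (hanti k hk).mono fun l hl => hl.trans_lt hkb

theorem exists_tendstoLocallyUniformlyOn (H : IsWeightedExhaustion D μ Ω ν) (m : ℕ) {w : ℂ}
    (hw : w ∈ Ω) : ∃ h : ℂ → ℂ, TendstoLocallyUniformlyOn
      (fun k z => reducedKernel (D k) (μ k) (m + 1) z w) h atTop Ω := by
  obtain ⟨α, hα, hge⟩ := H.exists_tendsto_weightedNormSq m hw
  have hcauchy : ∀ L ⊆ Ω, IsCompact L → UniformCauchySeqOn
      (fun k z => reducedKernel (D k) (μ k) (m + 1) z w) atTop L := by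
    intro L hLΩ hL
    obtain ⟨C, hC0, hC⟩ := H.exists_uniform_bound hL hLΩ
    rw [Metric.uniformCauchySeqOn_iff]
    intro ε hε
    have hlt : Tendsto (fun k => C * (weightedNormSq (D k) (μ k)
        (fun z => reducedKernel (D k) (μ k) (m + 1) z w) - α)) atTop (𝓝 0) := by
      simpa using (hα.sub_const α).const_mul C
    -- Two late indices need not be comparable, so both are compared on `D k` with one fixed `k`
    -- whose squared norm is close to `α`.
    obtain ⟨k, hkC, hkw, hkε⟩ := (hC.and ((H.eventually_mem hw).and
      (hlt.eventually (gt_mem_nhds (show 0 < (ε / 2) ^ 2 by positivity))))).exists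
    obtain ⟨N, hN⟩ := eventually_atTop.1 ((H.weightedNormSq_sub_le m hkw).and hge)
    have key : ∀ l ≥ N, ∀ z ∈ L, ‖reducedKernel (D k) (μ k) (m + 1) z w -
        reducedKernel (D l) (μ l) (m + 1) z w‖ < ε / 2 := by
      intro l hl z hz
      have h1 := hkC.2 _ ((H.isReducedRep m hkw).1.sub (hN l hl).1.1) z hz
      refine lt_of_pow_lt_pow_left₀ 2 (by positivity) ((h1.trans ?_).trans_lt hkε)
      exact mul_le_mul_of_nonneg_left ((hN l hl).1.2.trans (by linarith [(hN l hl).2])) hC0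
    refine ⟨N, fun l hl l' hl' z hz => ?_⟩
    have h1 := key l hl z hz
    have h2 := key l' hl' z hz
    rw [← dist_eq_norm, dist_comm] at h1
    rw [← dist_eq_norm] at h2
    exact (dist_triangle _ _ _).trans_lt (by linarith)
  have hex : ∀ z, ∃ c, z ∈ Ω → Tendsto (fun k => reducedKernel (D k) (μ k) (m + 1) z w) atTop
      (𝓝 c) := fun z => by
    by_cases hz : z ∈ Ω
    · obtain ⟨c, hc⟩ := cauchy_map_iff_exists_tendsto.1
        ((hcauchy {z} (Set.singleton_subset_iff.2 hz) isCompact_singleton).cauchy_map rfl)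
      exact ⟨c, fun _ => hc⟩
    · exact ⟨0, fun h => absurd h hz⟩
  choose h hh using hex
  refine ⟨h, (tendstoLocallyUniformlyOn_iff_forall_isCompact H.isOpen_lim).2 fun L hLΩ hL => ?_⟩
  exact (hcauchy L hLΩ hL).tendstoUniformlyOn_of_tendsto fun z hz => hh z (hLΩ hz)

/-- The limit `h` of the kernels is an admissible test function on `Ω` with `‖h‖² ≤ α = h⁽ᵐ⁾(w)`;
testing it against the kernel of `Ω` leaves no room between `α` and the squared norm of that kernel.
-/
theorem tendsto_weightedNormSq (H : IsWeightedExhaustion D μ Ω ν) (m : ℕ) {w : ℂ}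
    (hw : w ∈ Ω) : Tendsto (fun k => weightedNormSq (D k) (μ k)
      (fun z => reducedKernel (D k) (μ k) (m + 1) z w)) atTop
      (𝓝 (weightedNormSq Ω ν (fun z => reducedKernel Ω ν (m + 1) z w))) := by
  obtain ⟨α, hα, hge⟩ := H.exists_tendsto_weightedNormSq m hw
  obtain ⟨h, hh⟩ := H.exists_tendstoLocallyUniformlyOn m hw
  have hmem := H.eventually_mem hw
  obtain ⟨f, hf⟩ : ∃ f : ℕ → ℂ → ℂ, ∀ k, w ∈ D k → ∀ z ∈ D k,
      HasDerivAt (f k) (reducedKernel (D k) (μ k) (m + 1) z w) z := by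
    have : ∀ k, ∃ f : ℂ → ℂ, w ∈ D k → ∀ z ∈ D k,
        HasDerivAt f (reducedKernel (D k) (μ k) (m + 1) z w) z := fun k => by
      by_cases hk : w ∈ D k
      · obtain ⟨f, hf⟩ := (H.isReducedRep m hk).1.1
        exact ⟨f, fun _ => hf⟩
      · exact ⟨0, fun h => absurd h hk⟩
    exact ⟨_, fun k => (this k).choose_spec⟩
  have hball : ∀ z ∈ Ω, ∃ r > 0, Metric.ball z r ⊆ Ω ∧
      ∀ᶠ i in atTop, Metric.ball z r ⊆ D i := fun z hz => by
    obtain ⟨r, hr, hb⟩ := Metric.nhds_basis_closedBall.mem_iff.1 (H.isOpen_lim.mem_nhds hz)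
    obtain ⟨C, -, hC⟩ := H.exists_uniform_bound (isCompact_closedBall z r) hb
    exact ⟨r, hr, Metric.ball_subset_closedBall.trans hb,
      hC.mono fun i hi => Metric.ball_subset_closedBall.trans hi.1⟩
  -- The primitives live on varying domains, but every small ball in `Ω` lies in all late ones.
  obtain ⟨G, hG⟩ := exists_primitive_of_tendstoLocallyUniformlyOn H.isOpen_lim
    H.isPreconnected_lim (f := f) hh fun z hz => by
      obtain ⟨r, hr, hb, hi⟩ := hball z hz
      refine ⟨r, hr, hb, ?_⟩
      filter_upwards [hi, hmem] with i hi hiw y hy using hf i hiw y (hi hy)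
  have hcont : ContinuousOn h Ω := by
    have h1 : DifferentiableOn ℂ G Ω := fun z hz => (hG z hz).differentiableAt.differentiableWithinAt
    exact (h1.deriv H.isOpen_lim).continuousOn.congr fun z hz => (hG z hz).deriv.symm
  obtain ⟨hL2, hle⟩ := H.weightedNormSq_le_of_tendsto
    (hmem.mono fun k hk => (H.isReducedRep m hk).1) (fun z hz => hh.tendsto_at hz) hcont hα
  have hred : MemReduced Ω ν h := ⟨⟨G, hG⟩, hL2⟩
  have hderiv : ∀ k, Tendsto (fun i => iteratedDeriv k
      (fun z => reducedKernel (D i) (μ i) (m + 1) z w) w) atTop (𝓝 (iteratedDeriv k h w)) := by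
    obtain ⟨r, hr, hb, hi⟩ := hball w hw
    intro k
    refine ((hh.mono hb).iteratedDeriv_of_isOpen Metric.isOpen_ball ?_ k).tendsto_at
      (Metric.mem_ball_self hr)
    filter_upwards [hi, hmem] with i hi hiw
    exact ((H.isReducedRep m hiw).1.differentiableOn (H.domain i).1).mono hi
  have h0 : ∀ k < m, iteratedDeriv k h w = 0 := fun k hk => by
    refine tendsto_nhds_unique (hderiv k) (tendsto_const_nhds.congr' ?_)
    filter_upwards [hmem] with i hi using ((H.isReducedRep m hi).2.1 k hk).symm
  have hm : iteratedDeriv m h w = (α : ℂ) := by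
    refine tendsto_nhds_unique (hderiv m)
      (((Complex.continuous_ofReal.tendsto α).comp hα).congr' ?_)
    filter_upwards [hmem] with i hi using (H.isReducedRep m hi).iteratedDeriv_self.symm
  have hκ := H.isReducedRep_lim m hw
  have h1 := weightedNormSq_sub hL2 hκ.1.2
  rw [← hκ.2.2 h hred h0, hm, Complex.ofReal_re] at h1
  have h2 := weightedNormSq_nonneg (D := Ω) (μ := ν)
    (h - fun z => reducedKernel Ω ν (m + 1) z w)
  have h3 : weightedNormSq Ω ν (fun z => reducedKernel Ω ν (m + 1) z w) ≤ α := by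
    refine ge_of_tendsto hα (hmem.mono fun k hk => ?_)
    exact sub_nonneg.1 ((weightedNormSq_nonneg _).trans (H.weightedNormSq_sub_lim_le m hk).2)
  have h4 : α = weightedNormSq Ω ν (fun z => reducedKernel Ω ν (m + 1) z w) := by linarith
  rwa [← h4]

theorem tendstoLocallyUniformlyOn_reducedKernel (H : IsWeightedExhaustion D μ Ω ν) (m : ℕ)
    {w : ℂ} (hw : w ∈ Ω) : TendstoLocallyUniformlyOn
      (fun k z => reducedKernel (D k) (μ k) (m + 1) z w)
      (fun z => reducedKernel Ω ν (m + 1) z w) atTop Ω := by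
  refine (tendstoLocallyUniformlyOn_iff_forall_isCompact H.isOpen_lim).2 fun L hLΩ hL => ?_
  obtain ⟨C, hC0, hC⟩ := H.exists_uniform_bound hL hLΩ
  rw [Metric.tendstoUniformlyOn_iff]
  intro ε hε
  have hlt : Tendsto (fun k => C * (weightedNormSq (D k) (μ k)
      (fun z => reducedKernel (D k) (μ k) (m + 1) z w) -
      weightedNormSq Ω ν (fun z => reducedKernel Ω ν (m + 1) z w))) atTop (𝓝 0) := by
    simpa using ((H.tendsto_weightedNormSq m hw).sub_const
      (weightedNormSq Ω ν (fun z => reducedKernel Ω ν (m + 1) z w))).const_mul C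
  filter_upwards [hC, H.eventually_mem hw,
    hlt.eventually (gt_mem_nhds (show 0 < ε ^ 2 by positivity))] with k hkC hkw hkε z hz
  obtain ⟨h1, h2⟩ := H.weightedNormSq_sub_lim_le m hkw
  rw [dist_comm, dist_eq_norm]
  exact lt_of_pow_lt_pow_left₀ 2 hε.le (((hkC.2 _ ((H.isReducedRep m hkw).1.sub h1) z hz).trans
    (mul_le_mul_of_nonneg_left h2 hC0)).trans_lt hkε)

theorem kernelConvergence (H : IsWeightedExhaustion D μ Ω ν) : KernelConvergence D μ Ω ν where
  isOpen i := (H.domain i).1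
  isPreconnected i := (H.domain i).2.isPreconnected
  admissible := H.admissible
  isOpen_lim := H.isOpen_lim
  isPreconnected_lim := H.isPreconnected_lim
  admissible_lim := H.admissible_lim
  bound L hLΩ hL := by
    obtain ⟨C, hC0, hC⟩ := H.exists_uniform_bound hL hLΩ
    exact ⟨C, hC.mono fun i hi => ⟨hi.1, fun z hz w hw => norm_reducedKernel_le (H.admissible i)
      (H.domain i).1 (H.domain i).2.isPreconnected hi.1 hC0 hi.2 hz hw⟩⟩
  tendsto z hz w hw := (H.tendstoLocallyUniformlyOn_reducedKernel 0 hw).tendsto_at hz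

end IsWeightedExhaustion

/-! ### The theorem -/

theorem mainTheorem3 (D : ℕ → Set ℂ) (μ : ℕ → ℂ → ℝ)
    (hD : ∀ i, IsOpen (D i) ∧ IsConnected (D i))
    (hμ : ∀ i, IsAdmissibleWeight (D i) (μ i)) :
    -- Part (1)
    (∀ (Ω : Set ℂ) (ν : ℂ → ℝ), Ω = ⋃ i, D i → IsAdmissibleWeight Ω ν →
      (∀ i, ∃ j, ∀ k ≥ j, D i ⊆ D k ∧ ∀ z ∈ D i, μ i z ≤ μ k z ∧ μ k z ≤ ν z) →
      (∀ᵐ z ∂(volume.restrict Ω), Tendsto (fun i => μ i z) atTop (𝓝 (ν z))) →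
      TendstoLocallyUniformlyOn
        (fun i (p : ℂ × ℂ) => reducedKernel (D i) (μ i) 1 p.1 p.2)
        (fun p => reducedKernel Ω ν 1 p.1 p.2) atTop (Ω ×ˢ Ω) ∧
      ∀ n : ℕ, 1 < n →
        (∀ w ∈ Ω, TendstoLocallyUniformlyOn
          (fun i z => reducedKernel (D i) (μ i) n z w)
          (fun z => reducedKernel Ω ν n z w) atTop Ω) ∧
        (∀ z ∈ Ω, ∀ w ∈ Ω, Tendsto (fun i => reducedKernel (D i) (μ i) n z w) atTop
          (𝓝 (reducedKernel Ω ν n z w))) ∧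
        AllDerivsTendstoLocallyUniformlyOn
          (fun i p => reducedKernel (D i) (μ i) n p.1 p.2)
          (fun p => reducedKernel Ω ν n p.1 p.2) (Ω ×ˢ regularPoints Ω ν n)) ∧
    -- Part (2)
    (∀ (Ω : Set ℂ) (ν : ℂ → ℝ), Ω = ⋂ i, D i → IsOpen Ω → IsConnected Ω →
      IsAdmissibleWeight Ω ν →
      (∀ i, ∀ z ∈ Ω, ν z ≤ μ i z) →
      (∀ᵐ z ∂(volume.restrict Ω), Tendsto (fun i => μ i z) atTop (𝓝 (ν z))) →
      (∀ t ∈ Ω, Tendsto (fun i => reducedKernel (D i) (μ i) 1 t t) atTop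
        (𝓝 (reducedKernel Ω ν 1 t t))) →
      TendstoLocallyUniformlyOn
        (fun i (p : ℂ × ℂ) => reducedKernel (D i) (μ i) 1 p.1 p.2)
        (fun p => reducedKernel Ω ν 1 p.1 p.2) atTop (Ω ×ˢ Ω) ∧
      ∀ n : ℕ, 1 < n →
        AllDerivsTendstoLocallyUniformlyOn
          (fun i p => reducedKernel (D i) (μ i) n p.1 p.2)
          (fun p => reducedKernel Ω ν n p.1 p.2) (Ω ×ˢ regularPoints Ω ν n)) := by
  refine ⟨fun Ω ν hΩ hν hmono hlim => ?_, fun Ω ν hΩ hΩo hΩc hν hle _ hlim => ?_⟩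
  · have H : IsWeightedExhaustion D μ Ω ν := ⟨hD, hμ, hΩ, hν, hmono, hlim⟩
    refine ⟨H.kernelConvergence.tendstoLocallyUniformlyOn_reducedKernel, fun n hn => ?_⟩
    obtain ⟨m, rfl⟩ : ∃ m, n = m + 1 := ⟨n - 1, by omega⟩
    exact ⟨fun w hw => H.tendstoLocallyUniformlyOn_reducedKernel m hw,
      fun z hz w hw => (H.tendstoLocallyUniformlyOn_reducedKernel m hw).tendsto_at hz,
      H.kernelConvergence.allDerivsTendstoLocallyUniformlyOn hn⟩
  · have H := KernelConvergence.of_decreasing hD hμ hΩo hΩc.isPreconnected hν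
      (fun i => hΩ ▸ Set.iInter_subset D i) hle hlim
    exact ⟨H.tendstoLocallyUniformlyOn_reducedKernel,
      fun n hn => H.allDerivsTendstoLocallyUniformlyOn hn⟩
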